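/- **Setting.** Let $\mathcal G=(\mathcal V,\mathcal E)$ be a strongly connected directed graph with $n\ge 1$ nodes and diameter $\Delta$. Node $i$ evaluates a (measurable) subgradient oracle $\nabla f_i$ of its own function $f_i:\mathbb R^d\to\mathbb R$ in one unit of time; sending a value along an edge takes time $\tau\ge 0$; nodes work in parallel, and all other local operations are free. Let $\bar f=\frac1n\sum_i f_i$, let $\mathcal K\subset\mathbb R^d$ be closed and convex with $0\in\mathcal K$ and $\|\theta\|_2\le R$ for all $\theta\in\mathcal K$, and let $\theta^*$ be a minimizer of $\bar f$ over $\mathcal K$. *Assumption (A1), global regularity:* $\bar f$ is convex on $\mathbb R^d$ and $|\bar f(\theta)-\bar f(\theta')|\le L_g\|\theta-\theta'\|_2$ for all $\theta,\theta'\in\mathbb R^d$, where $L_g\ge 0$. (The $f_i$ need not be convex: it is enough that, for almost every $\theta$, $\nabla f_i(\theta)$ is a Fréchet subgradient of $f_i$ at $\theta$; for convex $f_i$ this is an ordinary subgradient.) *Algorithm (distributed randomized smoothing).* Given $\varepsilon>0$, let $\alpha_0=1$, $\alpha_{t+1}=2/(1+\sqrt{1+4/\alpha_t^2})$, $$T=\Big\lceil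 \tfrac{20RL_gd^{1/4}}{\varepsilon}\Big\rceil,\quad K=\Big\lceil \tfrac{5RL_gd^{-1/4}}{\varepsilon}\Big\rceil,\quad \gamma_t=Rd^{-1/4}\alpha_t,\quad \eta_t=\frac{R\alpha_t}{2L_g\big(d^{1/4}+\sqrt{(t+1)/K}\big)} .$$ Fix a root, a spanning tree directed away from the root and a spanning tree directed towards the root, both of depth at most $\Delta$ (they may be any such trees, chosen from the known graph at no cost in time). The root broadcasts a random seed, from which every node generates the same i.i.d. vectors $X_{t,k}\sim\mathcal N(0,I)$. Start with $x_0=z_0=G_0=0$. For $t=0,\dots,T-1$: the root broadcasts $y_t=(1-\alpha_t)x_t+\alpha_tz_t$; each node $i$ computes $g_i=\frac1K\sum_{k=1}^K\nabla f_i(y_t+\gamma_tX_{t,k})$ by $K$ successive oracle calls; the sum $\sum_i g_i$ is gathered at the root; and the root sets $G_{t+1}=G_t+\frac1{n\alpha_t}\sum_ig_i$, $z_{t+1}=\operatorname{argmin}_{x\in\mathcal K}\|x+\eta_{t+1}G_{t+1}\|_2^2$, $x_{t+1}=(1-\alpha_t)x_t+\alpha_tz_{t+1}$. The root returns $\theta_T=x_T$.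 **Theorem.** Under (A1), for every $\varepsilon>0$, the algorithm returns $\theta_T\in\mathcal K$ with $$\mathbb E[\bar f(\theta_T)]-\bar f(\theta^*)\le\varepsilon ,$$ and it does so in a time $T_\varepsilon$ that satisfies $$T_\varepsilon\le 40\Big\lceil\tfrac{RL_gd^{1/4}}{\varepsilon}\Big\rceil\Delta\tau+100\Big\lceil\tfrac{RL_gd^{1/4}}{\varepsilon}\Big\rceil\Big\lceil\tfrac{RL_gd^{-1/4}}{\varepsilon}\Big\rceil .$$ Consequently, there is a universal constant $C>0$ such that, whenever $\varepsilon\le RL_gd^{1/4}$, $$T_\varepsilon\le C\Big(\frac{RL_g}{\varepsilon}(\Delta\tau+1)\,d^{1/4}+\Big(\frac{RL_g}{\varepsilon}\Big)^2\Big).$$ -/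

import Mathlib

open MeasureTheory ProbabilityTheory Topology
open scoped NNReal

namespace DistOpt

/-! ### Networks: directed graphs, distances, spanning trees -/

section Network

variable {V : Type*}

/-- `v` can be reached from `u` by a directed walk with exactly `k` edges. -/
def ReachIn (G : Digraph V) : ℕ → V → V → Prop
  | 0, u, v => u = v
  | k + 1, u, v => ∃ w, ReachIn G k u w ∧ G.Adj w v

/-- Every vertex can be reached from every vertex by a directed walk. -/
def StronglyConnected (G : Digraph V) : Prop :=
  ∀ u v, ∃ k, ReachIn G k u v

/-- The least number of edges of a directed walk from `u` to `v`. -/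
noncomputable def dist (G : Digraph V) (u v : V) : ℕ :=
  sInf {k | ReachIn G k u v}

/-- The diameter: the largest distance between two vertices. -/
noncomputable def diam [Fintype V] (G : Digraph V) : ℕ :=
  Finset.univ.sup fun p : V × V => dist G p.1 p.2

/-- A spanning tree of `G` rooted at `r` whose edges `parent v → v` point away from the root.
A spanning tree whose edges point towards the root is an `Arborescence (reverse G) r`. -/
structure Arborescence (G : Digraph V) (r : V) where
  parent : V → V
  /-- number of edges of the tree between the root and a vertex -/
  depth : V → ℕ
  depth_eq_zero : ∀ v, depth v = 0 ↔ v = r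
  adj : ∀ v, v ≠ r → G.Adj (parent v) v
  depth_parent : ∀ v, v ≠ r → depth v = depth (parent v) + 1

/-- The digraph with all edges reversed. -/
def reverse (G : Digraph V) : Digraph V := ⟨fun u v => G.Adj v u⟩

/-- The children of `v` in a rooted spanning tree. -/
noncomputable def Arborescence.children [Fintype V] {G : Digraph V} {r : V}
    (A : Arborescence G r) (v : V) : Finset V :=
  open Classical in Finset.univ.filter fun w => w ≠ r ∧ A.parent w = v

/-- The largest depth of a vertex. -/
def Arborescence.height [Fintype V] {G : Digraph V} {r : V} (A : Arborescence G r) : ℕ :=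
  Finset.univ.sup A.depth

theorem reachIn_reverse {G : Digraph V} {k : ℕ} {u v : V} :
    ReachIn (reverse G) k u v ↔ ReachIn G k v u := by
  have cons : ∀ (G : Digraph V) (k : ℕ) (a b c : V), G.Adj a b → ReachIn G k b c →
      ReachIn G (k + 1) a c := by
    intro G k
    induction k with
    | zero => rintro a b c h rfl; exact ⟨a, rfl, h⟩
    | succ k ih => rintro a b c h ⟨w, hw, hwc⟩; exact ⟨w, ih a b w h hw, hwc⟩
  have key : ∀ (G : Digraph V) (k : ℕ) (u v : V), ReachIn G k v u → ReachIn (reverse G) k u v := by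
    intro G k
    induction k with
    | zero => rintro u v rfl; rfl
    | succ k ih =>
      rintro u v ⟨w, hw, hwu⟩
      exact cons (reverse G) k u w v hwu (ih w v hw)
  exact ⟨fun h => key (reverse G) k v u h, key G k u v⟩

theorem dist_reverse (G : Digraph V) (u v : V) : dist (reverse G) u v = dist G v u := by
  simp only [dist, reachIn_reverse]

theorem StronglyConnected.reverse {G : Digraph V} (h : StronglyConnected G) :
    StronglyConnected (reverse G) := fun u v =>
  (h v u).imp fun _ hk => reachIn_reverse.2 hk

theorem diam_reverse [Fintype V] (G : Digraph V) : diam (reverse G) = diam G := by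
  have key : ∀ G : Digraph V, diam (DistOpt.reverse G) ≤ diam G := by
    intro G
    refine Finset.sup_le fun p _ => ?_
    rw [dist_reverse]
    exact Finset.le_sup (f := fun p : V × V => dist G p.1 p.2) (Finset.mem_univ (p.2, p.1))
  exact le_antisymm (key G) (key (DistOpt.reverse G))

/-- A strongly connected digraph has, for every root, a spanning tree of depth at most the
diameter, and by `diam_reverse` the same holds for trees directed towards the root. -/
theorem StronglyConnected.exists_arborescence [Fintype V] {G : Digraph V}
    (h : StronglyConnected G) (r : V) :
    ∃ A : Arborescence G r, ∀ v, A.depth v ≤ diam G := by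
  have hd : ∀ v, ReachIn G (dist G r v) r v := fun v => Nat.sInf_mem (h r v)
  have hle : ∀ v k, ReachIn G k r v → dist G r v ≤ k := fun v k hk => Nat.sInf_le hk
  have hp : ∀ v, v ≠ r → ∃ w, G.Adj w v ∧ dist G r v = dist G r w + 1 := by
    intro v hv
    have h1 := hd v
    cases hk : dist G r v with
    | zero => rw [hk] at h1; exact absurd h1.symm hv
    | succ k =>
      rw [hk] at h1
      obtain ⟨w, hw, hwv⟩ := h1
      refine ⟨w, hwv, ?_⟩
      have h2 := hle w k hw
      have h3 := hle v (dist G r w + 1) ⟨w, hd w, hwv⟩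
      omega
  choose! p hpa hpd using hp
  refine ⟨⟨p, dist G r, fun v => ⟨fun h0 => ?_, ?_⟩, hpa, hpd⟩, fun v => ?_⟩
  · have h1 := hd v
    rw [h0] at h1
    exact h1.symm
  · rintro rfl
    exact Nat.le_zero.1 (hle v 0 rfl)
  · exact Finset.le_sup (f := fun p : V × V => dist G p.1 p.2) (Finset.mem_univ (r, v))

end Network

/-! ### Cost model

A `Timed α` is a value together with the time at which the node holding it has it at its disposal.
The algorithm is written with the following operations only, so that its run carries its own
running time: local operations other than subgradient evaluations are free, a node's evaluation of
a subgradient of its own function takes one unit of time, and sending a value along an edge of the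
network takes time `τ`. -/

structure Timed (α : Type*) where
  val : α
  time : ℝ≥0

namespace Timed

variable {α β δ : Type*}

/-- A value available from the start. -/
def pure (a : α) : Timed α := ⟨a, 0⟩

/-- A free local operation on one value. -/
def map (φ : α → β) (a : Timed α) : Timed β := ⟨φ a.val, a.time⟩

/-- A free local operation on two values; it waits until both are available. -/
noncomputable def map₂ (φ : α → β → δ) (a : Timed α) (b : Timed β) : Timed δ :=
  ⟨φ a.val b.val, max a.time b.time⟩

/-- The sum of finitely many values; it waits until all are available. -/
noncomputable def sum {ι : Type*} [AddCommMonoid α] (s : Finset ι) (a : ι → Timed α) : Timed α :=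
  ⟨∑ i ∈ s, (a i).val, s.sup fun i => (a i).time⟩

/-- An evaluation of the subgradient oracle `g`: one unit of time. -/
noncomputable def query (g : α → β) (a : Timed α) : Timed β := ⟨g a.val, a.time + 1⟩

/-- A transmission along one edge: time `τ`. -/
noncomputable def send (τ : ℝ≥0) (a : Timed α) : Timed α := ⟨a.val, a.time + τ⟩

end Timed

section Communication

variable {V : Type*} {G : Digraph V} {r : V} {α : Type*}

/-- `broadcastTo A τ a k v`: what a vertex `v` of depth `k` receives when the root holds `a` and
every vertex forwards what it has received from its parent to its children. -/
noncomputable def broadcastTo (A : Arborescence G r) (τ : ℝ≥0) (a : Timed α) : ℕ → V → Timed α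
  | 0, _ => a
  | k + 1, v => Timed.send τ (broadcastTo A τ a k (A.parent v))

/-- The copy held by node `v` of a value broadcast by the root through the tree. -/
noncomputable def broadcast (A : Arborescence G r) (τ : ℝ≥0) (a : Timed α) (v : V) : Timed α :=
  broadcastTo A τ a (A.depth v) v

/-- `gatherAt B τ b h v`: the sum of the local values `b` over the subtree below `v`, cut `h` levels
below `v`. A node waits for the partial sums of its children and for its own value; it sends the
total to its parent along the edge `v → parent v`. -/
noncomputable def gatherAt [Fintype V] [AddCommMonoid α] (B : Arborescence (reverse G) r)
    (τ : ℝ≥0) (b : V → Timed α) : ℕ → V → Timed α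
  | 0, v => b v
  | h + 1, v => Timed.map₂ (fun x y => x + y) (b v)
      (Timed.sum (B.children v) fun w => Timed.send τ (gatherAt B τ b h w))

/-- The sum of the values held by all nodes, as obtained at the root. -/
noncomputable def gather [Fintype V] [AddCommMonoid α] (B : Arborescence (reverse G) r)
    (τ : ℝ≥0) (b : V → Timed α) : Timed α :=
  gatherAt B τ b B.height r

end Communication

/-! ### Objective function and subgradients -/

/-- `ℝ^d` with the Euclidean norm. -/
abbrev Vec (d : ℕ) := EuclideanSpace ℝ (Fin d)

/-- The average of the local functions. -/
noncomputable def avg {V : Type*} [Fintype V] {d : ℕ} (f : V → Vec d → ℝ) (θ : Vec d) : ℝ :=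
  (1 / (Fintype.card V : ℝ)) * ∑ i, f i θ

/-- `s` is a (Fréchet) subgradient of `f` at `θ`. For a convex function this is the usual
subgradient, see `isSubgradientAt_iff_of_convexOn`; local functions need not be convex. -/
def IsSubgradientAt {d : ℕ} (f : Vec d → ℝ) (s θ : Vec d) : Prop :=
  ∀ c > 0, ∀ᶠ x in 𝓝 θ, f θ + inner ℝ s (x - θ) - c * ‖x - θ‖ ≤ f x

theorem isSubgradientAt_iff_of_convexOn {d : ℕ} {f : Vec d → ℝ} (hf : ConvexOn ℝ Set.univ f)
    (s θ : Vec d) :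
    IsSubgradientAt f s θ ↔ ∀ x, f θ + inner ℝ s (x - θ) ≤ f x := by
  constructor
  · intro h x
    refine le_of_forall_pos_le_add fun ε hε => ?_
    have hn : 0 < ‖x - θ‖ + 1 := by positivity
    have hc : 0 < ε / (‖x - θ‖ + 1) := by positivity
    have hcont : Filter.Tendsto (fun t : ℝ => θ + t • (x - θ)) (𝓝[>] 0) (𝓝 θ) := by
      have : Continuous (fun t : ℝ => θ + t • (x - θ)) := by fun_prop
      simpa using (this.tendsto 0).mono_left nhdsWithin_le_nhds
    have h1 : ∀ᶠ t : ℝ in 𝓝[>] 0, t ≤ 1 :=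
      nhdsWithin_le_nhds (Iic_mem_nhds one_pos)
    obtain ⟨t, ht, ht1, ht0⟩ :=
      ((hcont.eventually (h _ hc)).and (h1.and self_mem_nhdsWithin)).exists
    have ht0 : 0 < t := ht0
    have hcv := hf.2 (Set.mem_univ θ) (Set.mem_univ x) (sub_nonneg.2 ht1) ht0.le (by ring)
    have e : (1 - t) • θ + t • x = θ + t • (x - θ) := by module
    rw [e] at hcv
    simp only [add_sub_cancel_left, inner_smul_right, norm_smul, Real.norm_eq_abs,
      abs_of_pos ht0, smul_eq_mul] at ht hcv
    have h2 : t * (f θ + inner ℝ s (x - θ)) ≤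
        t * (f x + ε / (‖x - θ‖ + 1) * ‖x - θ‖) := by nlinarith
    have h3 := le_of_mul_le_mul_left h2 ht0
    have h4 : ε / (‖x - θ‖ + 1) * ‖x - θ‖ ≤ ε := by
      rw [div_mul_eq_mul_div, div_le_iff₀ hn]
      nlinarith
    linarith
  · intro h c hc
    filter_upwards with x
    have := h x
    have : 0 ≤ c * ‖x - θ‖ := by positivity
    linarith

/-! ### Distributed randomized smoothing -/

/-- `α₀ = 1`, `α_{t+1} = 2 / (1 + √(1 + 4 / α_t²))`. -/
noncomputable def alpha : ℕ → ℝ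
  | 0 => 1
  | t + 1 => 2 / (1 + √(1 + 4 / alpha t ^ 2))

/-- Number of iterations `T = ⌈20 R L d^{1/4} / ε⌉`. -/
noncomputable def numIter (R L ε : ℝ) (d : ℕ) : ℕ :=
  ⌈20 * R * L * (d : ℝ) ^ (1 / 4 : ℝ) / ε⌉₊

/-- Number of samples per iteration `K = ⌈5 R L d^{-1/4} / ε⌉`. -/
noncomputable def numSamples (R L ε : ℝ) (d : ℕ) : ℕ :=
  ⌈5 * R * L * (d : ℝ) ^ (-(1 / 4) : ℝ) / ε⌉₊

/-- Smoothing radius `γ_t = R d^{-1/4} α_t`. -/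
noncomputable def gammaSmooth (R : ℝ) (d t : ℕ) : ℝ :=
  R * (d : ℝ) ^ (-(1 / 4) : ℝ) * alpha t

/-- Step size `η_t = R α_t / (2 L (d^{1/4} + √((t + 1) / K)))`. -/
noncomputable def etaStep (R L : ℝ) (d K t : ℕ) : ℝ :=
  R * alpha t / (2 * L * ((d : ℝ) ^ (1 / 4 : ℝ) + √(((t : ℝ) + 1) / K)))

/-- A minimizer of `φ` over `S` (arbitrary if there is none). -/
noncomputable def argminOn {d : ℕ} (S : Set (Vec d)) (φ : Vec d → ℝ) : Vec d :=
  Classical.epsilon fun x => x ∈ S ∧ IsMinOn φ S x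

/-- The variables kept at the root. -/
structure RootState (d : ℕ) where
  x : Vec d
  z : Vec d
  G : Vec d

/-- A node evaluates its oracle `g` at `p 0, …, p (k - 1)`, one point after the other, and
accumulates the sum of the results; it starts as soon as `start` is reached. -/
noncomputable def querySum {d : ℕ} (g : Vec d → Vec d) (p : ℕ → Timed (Vec d)) :
    ℕ → Timed (Vec d)
  | 0 => Timed.pure 0
  | k + 1 =>
      Timed.map₂ (fun x y => x + y) (querySum g p k)
        (Timed.query g (Timed.map₂ (fun _ y => y) (querySum g p k) (p k)))

section Algorithm

variable {V Ω : Type*} [Fintype V] {Gr : Digraph V} {r : V} {d : ℕ}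

/-- The value `g_i = (1/K) ∑_k ∇f_i (y + γ X_k)` computed by a node with oracle `g`, from its copies
of `y` and of the random seed; `X k` is the random number generator. -/
noncomputable def localGradient (g : Vec d → Vec d) (X : ℕ → Ω → Vec d) (γ : ℝ) (K : ℕ)
    (seed : Timed Ω) (y : Timed (Vec d)) : Timed (Vec d) :=
  (querySum g (fun k => Timed.map₂ (fun s y => y + γ • X k s) seed y) K).map
    fun S => (1 / (K : ℝ)) • S

/-- Iteration `t` of distributed randomized smoothing: the root computes `y_t` and broadcasts it
along the tree `A`, the nodes compute their `g_i` in parallel, the sum of the `g_i` is gathered at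
the root along the tree `B`, and the root updates `G`, `z` and `x`. -/
noncomputable def drsStep (A : Arborescence Gr r) (B : Arborescence (reverse Gr) r) (τ : ℝ≥0)
    (S : Set (Vec d)) (g : V → Vec d → Vec d) (X : ℕ → ℕ → Ω → Vec d) (R L : ℝ) (K : ℕ)
    (seed : V → Timed Ω) (t : ℕ) (s : Timed (RootState d)) : Timed (RootState d) :=
  let y := s.map fun s => (1 - alpha t) • s.x + alpha t • s.z
  let gSum := gather B τ fun i =>
    localGradient (g i) (X t) (gammaSmooth R d t) K (seed i) (broadcast A τ y i)
  Timed.map₂ (fun s gS =>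
      let G' := s.G + (1 / ((Fintype.card V : ℝ) * alpha t)) • gS
      let z' := argminOn S fun x => ‖x + etaStep R L d K (t + 1) • G'‖ ^ 2
      { x := (1 - alpha t) • s.x + alpha t • z', z := z', G := G' })
    s gSum

/-- The root variables after `t` iterations, when the root draws the seed `ω` at time `0` and
broadcasts it along `A`. -/
noncomputable def drsState (A : Arborescence Gr r) (B : Arborescence (reverse Gr) r) (τ : ℝ≥0)
    (S : Set (Vec d)) (g : V → Vec d → Vec d) (X : ℕ → ℕ → Ω → Vec d) (R L : ℝ) (K : ℕ) (ω : Ω) :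
    ℕ → Timed (RootState d)
  | 0 => Timed.pure { x := 0, z := 0, G := 0 }
  | t + 1 =>
      drsStep A B τ S g X R L K (broadcast A τ (Timed.pure ω)) t
        (drsState A B τ S g X R L K ω t)

/-- Distributed randomized smoothing with target precision `ε`: its output `θ_T`, and the time at
which the root returns it. -/
noncomputable def drs (A : Arborescence Gr r) (B : Arborescence (reverse Gr) r) (τ : ℝ≥0)
    (S : Set (Vec d)) (g : V → Vec d → Vec d) (X : ℕ → ℕ → Ω → Vec d) (R L ε : ℝ) (ω : Ω) :
    Timed (Vec d) :=
  (drsState A B τ S g X R L (numSamples R L ε d) ω (numIter R L ε d)).map fun s => s.x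

end Algorithm

end DistOpt

namespace DistOpt

/-! ### Values and running times -/

section Run

variable {V α Ω : Type*} {G : Digraph V} {r : V} {d : ℕ}

/-! All nodes generate the same samples, so the sum gathered at the root is what a single machine
would compute from the averaged oracle (`drsState_val`). That oracle is almost everywhere a Fréchet
subgradient of the convex function `avg f`, hence an ordinary subgradient, of norm at most L; the
local functions need no regularity of their own. What remains is the analysis of centralized
randomized smoothing and a count of the time per iteration.

Let F_γ(x) = E f(x + γZ) with Z standard Gaussian. Then f ≤ F_γ ≤ f + Lγ√d, and F_γ increases with
γ. It also has a quadratic upper bound with constant L/γ (`smooth_add_le`), free of the dimension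
because translating the Gaussian density by u moves it by at most ‖u‖ in L¹
(`integral_abs_gaussDensity_sub_le`). So an accelerated method applies to F_γ, fed with averages of
K oracle values, which are unbiased with mean squared error at most L²/K
(`integral_norm_sq_avg_sampleError_le`).

`accelerated_dual_averaging_le` bounds every path, noise included. In expectation the linear noise
vanishes, each sample being independent of the past. With γ_t proportional to d^{-1/4} α_t, bias and
curvature cost LRd^{1/4}/T and the noise costs LR/√(TK), up to constants (`integral_gap_le`); T and
K are chosen to bring the total below ε. One iteration takes time at most 2Δτ + K. -/

theorem broadcastTo_val (A : Arborescence G r) (τ : ℝ≥0) (a : Timed α) (k : ℕ) (v : V) :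
    (broadcastTo A τ a k v).val = a.val := by
  induction k generalizing v with
  | zero => rfl
  | succ k ih => exact ih _

theorem broadcastTo_time (A : Arborescence G r) (τ : ℝ≥0) (a : Timed α) (k : ℕ) (v : V) :
    (broadcastTo A τ a k v).time = a.time + k * τ := by
  induction k generalizing v with
  | zero => simp [broadcastTo]
  | succ k ih => simp only [broadcastTo, Timed.send, ih]; push_cast; ring

theorem broadcast_val (A : Arborescence G r) (τ : ℝ≥0) (a : Timed α) (v : V) :
    (broadcast A τ a v).val = a.val := broadcastTo_val ..

theorem broadcast_time (A : Arborescence G r) (τ : ℝ≥0) (a : Timed α) (v : V) :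
    (broadcast A τ a v).time = a.time + A.depth v * τ := broadcastTo_time ..

/-- Summed over a layer of the tree, the partial sums cover the next `h` layers. -/
theorem sum_layer_gatherAt_val [Fintype V] [AddCommMonoid α] (B : Arborescence (reverse G) r)
    (τ : ℝ≥0) (b : V → Timed α) (h k : ℕ) :
    ∑ v with B.depth v = k, (gatherAt B τ b h v).val =
      ∑ w with k ≤ B.depth w ∧ B.depth w ≤ k + h, (b w).val := by
  classical
  induction h generalizing k with
  | zero =>
    simp only [gatherAt]
    refine Finset.sum_congr (Finset.filter_congr fun v _ => ?_) fun _ _ => rfl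
    omega
  | succ h ih =>
    -- Every vertex of layer k + 1 has exactly one parent, and it lies in layer k, so the pairs
    -- (vertex, child) enumerate layer k + 1 once.
    have hchild : ∑ v with B.depth v = k, ∑ w ∈ B.children v, (gatherAt B τ b h w).val =
        ∑ w with B.depth w = k + 1, (gatherAt B τ b h w).val := by
      rw [Finset.sum_sigma']
      refine Finset.sum_bij' (fun p _ => p.2) (fun w _ => ⟨B.parent w, w⟩) ?_ ?_ ?_ ?_ ?_
      · rintro ⟨v, w⟩ hp
        simp only [Finset.mem_sigma, Finset.mem_filter, Finset.mem_univ, true_and,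
          Arborescence.children] at hp ⊢
        rw [B.depth_parent w hp.2.1, hp.2.2, hp.1]
      · intro w hw
        simp only [Finset.mem_sigma, Finset.mem_filter, Finset.mem_univ, true_and,
          Arborescence.children, and_true] at hw ⊢
        have hr : w ≠ r := fun e => by
          have := (B.depth_eq_zero w).2 e
          omega
        have := B.depth_parent w hr
        exact ⟨by omega, hr⟩
      · rintro ⟨v, w⟩ hp
        simp only [Finset.mem_sigma, Finset.mem_filter, Finset.mem_univ, true_and,
          Arborescence.children] at hp
        rw [hp.2.2]
      · intro w _
        rfl
      · intro p _
        rfl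
    simp only [gatherAt, Timed.map₂, Timed.sum, Timed.send, Finset.sum_add_distrib, hchild, ih]
    rw [← Finset.sum_union (by
      rw [Finset.disjoint_filter]
      intro w _ h1 h2
      omega)]
    refine Finset.sum_congr ?_ fun _ _ => rfl
    ext w
    simp only [Finset.mem_union, Finset.mem_filter, Finset.mem_univ, true_and]
    omega

theorem gather_val [Fintype V] [AddCommMonoid α] (B : Arborescence (reverse G) r)
    (τ : ℝ≥0) (b : V → Timed α) : (gather B τ b).val = ∑ v, (b v).val := by
  classical
  have h := sum_layer_gatherAt_val B τ b B.height 0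
  have hroot : (Finset.univ.filter fun v => B.depth v = 0) = {r} := by
    ext v
    simp [B.depth_eq_zero]
  rw [hroot, Finset.sum_singleton] at h
  rw [gather, h, Finset.filter_true_of_mem]
  intro v _
  have hv : B.depth v ≤ B.height := Finset.le_sup (f := B.depth) (Finset.mem_univ v)
  omega

theorem gatherAt_time_le [Fintype V] [AddCommMonoid α] (B : Arborescence (reverse G) r)
    (τ : ℝ≥0) (b : V → Timed α) {M : ℝ≥0} (hb : ∀ v, (b v).time ≤ M) (h : ℕ) (v : V) :
    (gatherAt B τ b h v).time ≤ M + h * τ := by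
  induction h generalizing v with
  | zero => simpa [gatherAt] using hb v
  | succ h ih =>
    refine max_le ((hb v).trans (by simp)) (Finset.sup_le fun w _ => ?_)
    calc (gatherAt B τ b h w).time + τ ≤ M + h * τ + τ := by gcongr; exact ih w
      _ = M + (h + 1 : ℕ) * τ := by push_cast; ring

theorem querySum_val (g : Vec d → Vec d) (p : ℕ → Timed (Vec d)) (k : ℕ) :
    (querySum g p k).val = ∑ j ∈ Finset.range k, g (p j).val := by
  induction k with
  | zero => rfl
  | succ k ih => rw [Finset.sum_range_succ, ← ih]; rfl

theorem querySum_time_le (g : Vec d → Vec d) (p : ℕ → Timed (Vec d)) {M : ℝ≥0}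
    (hp : ∀ j, (p j).time ≤ M) (k : ℕ) : (querySum g p k).time ≤ M + k := by
  induction k with
  | zero => simp [querySum, Timed.pure]
  | succ k ih =>
    have h1 : M + (k : ℝ≥0) ≤ M + (k + 1 : ℕ) := by push_cast; gcongr; simp
    refine max_le (ih.trans h1) ?_
    have h2 : max (querySum g p k).time (p k).time + 1 ≤ M + k + 1 := by
      gcongr
      exact max_le ih ((hp k).trans (by simp))
    calc _ ≤ M + k + 1 := h2
      _ = M + (k + 1 : ℕ) := by push_cast; ring

variable [Fintype V]

/-- The average of the local oracles. -/
noncomputable def avgOracle (g : V → Vec d → Vec d) (θ : Vec d) : Vec d :=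
  (1 / (Fintype.card V : ℝ)) • ∑ i, g i θ

/-- One update of the root variables from a global gradient oracle `s` and samples `W`. -/
noncomputable def stepVal (S : Set (Vec d)) (s : Vec d → Vec d) (R L : ℝ) (K t : ℕ)
    (W : ℕ → Vec d) (q : RootState d) : RootState d :=
  let y := (1 - alpha t) • q.x + alpha t • q.z
  let G' := q.G + (1 / alpha t) •
    ((1 / (K : ℝ)) • ∑ k ∈ Finset.range K, s (y + gammaSmooth R d t • W k))
  let z' := argminOn S fun x => ‖x + etaStep R L d K (t + 1) • G'‖ ^ 2
  { x := (1 - alpha t) • q.x + alpha t • z', z := z', G := G' }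

/-- The root variables of centralized randomized smoothing. -/
noncomputable def stateVal (S : Set (Vec d)) (s : Vec d → Vec d) (R L : ℝ) (K : ℕ)
    (W : ℕ → ℕ → Vec d) : ℕ → RootState d
  | 0 => { x := 0, z := 0, G := 0 }
  | t + 1 => stepVal S s R L K t (W t) (stateVal S s R L K W t)

/-- The sums over nodes and over samples can be exchanged because the seed, and hence each
perturbation, is common to all nodes. -/
theorem drsState_val (A : Arborescence G r) (B : Arborescence (reverse G) r) (τ : ℝ≥0)
    (S : Set (Vec d)) (g : V → Vec d → Vec d) (X : ℕ → ℕ → Ω → Vec d) (R L : ℝ) (K : ℕ) (ω : Ω)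
    (t : ℕ) :
    (drsState A B τ S g X R L K ω t).val =
      stateVal S (avgOracle g) R L K (fun t k => X t k ω) t := by
  induction t with
  | zero => rfl
  | succ t ih =>
    have hG : (1 / ((Fintype.card V : ℝ) * alpha t)) • (gather B τ fun i =>
        localGradient (g i) (X t) (gammaSmooth R d t) K (broadcast A τ (Timed.pure ω) i)
          (broadcast A τ ((drsState A B τ S g X R L K ω t).map
            fun s => (1 - alpha t) • s.x + alpha t • s.z) i)).val =
        (1 / alpha t) • ((1 / (K : ℝ)) • ∑ k ∈ Finset.range K,
          avgOracle g (((1 - alpha t) • (drsState A B τ S g X R L K ω t).val.x +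
            alpha t • (drsState A B τ S g X R L K ω t).val.z) +
              gammaSmooth R d t • X t k ω)) := by
      simp only [gather_val, localGradient, Timed.map, querySum_val, Timed.map₂, broadcast_val,
        Timed.pure, avgOracle, ← Finset.smul_sum, smul_smul]
      rw [Finset.sum_comm]
      congr 1
      ring
    rw [stateVal, ← ih]
    simp only [drsState, drsStep, stepVal]
    rw [← hG]
    rfl

/-- Each iteration pays for one broadcast, K successive queries made by all nodes in parallel, and
one gathering. -/
theorem drsState_time_le (A : Arborescence G r) (B : Arborescence (reverse G) r) (τ : ℝ≥0)
    (S : Set (Vec d)) (g : V → Vec d → Vec d) (X : ℕ → ℕ → Ω → Vec d) (R L : ℝ) (K : ℕ) (ω : Ω)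
    {D : ℕ} (hA : ∀ v, A.depth v ≤ D) (hB : ∀ v, B.depth v ≤ D) (t : ℕ) :
    (drsState A B τ S g X R L K ω t).time ≤ t * (2 * (D * τ) + K) := by
  induction t with
  | zero => simp [drsState, Timed.pure]
  | succ t ih =>
    set M : ℝ≥0 := t * (2 * (D * τ) + K) with hM
    have hdepth : ∀ v, (A.depth v : ℝ≥0) * τ ≤ D * τ := fun v => by
      gcongr
      exact hA v
    have hheight : (B.height : ℝ≥0) * τ ≤ D * τ := by
      gcongr
      exact Finset.sup_le fun v _ => hB v
    have hstep : M + D * τ + K + D * τ = (t + 1 : ℕ) * (2 * (D * τ) + K) := by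
      rw [hM]; push_cast; ring
    rw [← hstep]
    refine max_le (ih.trans (by rw [add_assoc, add_assoc]; exact le_self_add)) ?_
    refine (gatherAt_time_le B τ _ (M := M + D * τ + K) (fun v => ?_) _ _).trans (by gcongr)
    refine querySum_time_le _ _ (fun j => max_le ?_ ?_) _
    -- The seed travels alongside the first broadcast of y, so it adds nothing to the total.
    · rw [broadcast_time]
      simp only [Timed.pure, zero_add]
      exact (hdepth v).trans le_add_self
    · rw [broadcast_time]
      exact add_le_add ih (hdepth v)

end Run

/-! ### The standard Gaussian measure -/

section Gaussian

variable {E : Type*} [NormedAddCommGroup E] [InnerProductSpace ℝ E]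

/-- Density of the standard Gaussian measure. -/
noncomputable def gaussDensity (x : E) : ℝ :=
  (2 * Real.pi) ^ (-(Module.finrank ℝ E / 2 : ℝ)) * Real.exp (-(1 / 2) * ‖x‖ ^ 2)

theorem gaussDensity_pos (x : E) : 0 < gaussDensity x := by
  unfold gaussDensity; positivity

theorem continuous_gaussDensity : Continuous (gaussDensity : E → ℝ) := by
  unfold gaussDensity; fun_prop

/-- Completing the square at the midpoint u/2. Integrated, this gives the Hellinger affinity
exp(-‖u‖²/8) of two translates, from which the total variation bound follows. -/
theorem sqrt_gaussDensity_mul (u x : E) :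
    √(gaussDensity (x - u)) * √(gaussDensity x) =
      Real.exp (-(‖u‖ ^ 2 / 8)) * gaussDensity (x - (1 / 2 : ℝ) • u) := by
  rw [← Real.sqrt_mul (gaussDensity_pos _).le, Real.sqrt_eq_iff_mul_self_eq_of_pos
    (by have := gaussDensity_pos (x - (1 / 2 : ℝ) • u); positivity)]
  unfold gaussDensity
  have h : -(1 / 2) * ‖x - u‖ ^ 2 + -(1 / 2) * ‖x‖ ^ 2 =
      2 * (-(‖u‖ ^ 2 / 8)) + 2 * (-(1 / 2) * ‖x - (1 / 2 : ℝ) • u‖ ^ 2) := by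
    rw [norm_sub_sq_real, norm_sub_sq_real, real_inner_smul_right, norm_smul, Real.norm_eq_abs,
      abs_of_pos (by norm_num : (0 : ℝ) < 1 / 2)]
    ring
  have h2 := congrArg Real.exp h
  rw [Real.exp_add, Real.exp_add, two_mul, Real.exp_add, two_mul, Real.exp_add] at h2
  linear_combination (-((2 * Real.pi) ^ (-(Module.finrank ℝ E / 2 : ℝ))) ^ 2) * h2

variable [FiniteDimensional ℝ E] [MeasurableSpace E] [BorelSpace E]

theorem integral_gaussDensity : ∫ x : E, gaussDensity x = 1 := by
  simp only [gaussDensity]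
  rw [integral_const_mul, GaussianFourier.integral_rexp_neg_mul_sq_norm (by norm_num),
    show Real.pi / (1 / 2) = 2 * Real.pi by ring, Real.rpow_neg (by positivity)]
  exact inv_mul_cancel₀ (by positivity)

theorem integrable_gaussDensity : Integrable (gaussDensity : E → ℝ) := by
  by_contra h
  have := integral_gaussDensity (E := E)
  rw [integral_undef h] at this
  exact zero_ne_one this

/-- Both measures are finite and have the same characteristic function. The density gives absolute
continuity and makes translates comparable. -/
theorem stdGaussian_eq_withDensity :
    stdGaussian E = (volume : Measure E).withDensity fun x => ENNReal.ofReal (gaussDensity x) := by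
  have : IsFiniteMeasure
      ((volume : Measure E).withDensity fun x => ENNReal.ofReal (gaussDensity x)) :=
    isFiniteMeasure_withDensity_ofReal integrable_gaussDensity.2
  refine Measure.ext_of_charFun (funext fun t => ?_)
  rw [charFun_stdGaussian, charFun_apply,
    integral_withDensity_eq_integral_toReal_smul (by
      exact continuous_gaussDensity.measurable.ennreal_ofReal) (by simp)]
  have h := GaussianFourier.integral_cexp_neg_mul_sq_norm_add (V := E) (b := (1 / 2 : ℂ))
    (by norm_num) Complex.I t
  have e : ∀ x : E, (ENNReal.ofReal (gaussDensity x)).toReal •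
      Complex.exp ((inner ℝ x t : ℝ) * Complex.I) =
      (((2 * Real.pi) ^ (-(Module.finrank ℝ E / 2 : ℝ)) : ℝ) : ℂ) *
        Complex.exp (-(1 / 2) * (‖x‖ : ℂ) ^ 2 + Complex.I * (inner ℝ t x : ℝ)) := by
    intro x
    rw [ENNReal.toReal_ofReal (gaussDensity_pos x).le, Complex.exp_add, gaussDensity,
      Complex.real_smul, Complex.ofReal_mul, Complex.ofReal_exp, mul_assoc, real_inner_comm,
      mul_comm Complex.I]
    push_cast
    rfl
  simp_rw [e]
  rw [integral_const_mul, h, ← mul_assoc]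
  have e2 : (((2 * Real.pi) ^ (-(Module.finrank ℝ E / 2 : ℝ)) : ℝ) : ℂ) *
      ((Real.pi : ℂ) / (1 / 2)) ^ (Module.finrank ℝ E / 2 : ℂ) = 1 := by
    have : ((Real.pi : ℂ) / (1 / 2)) ^ (Module.finrank ℝ E / 2 : ℂ) =
        (((2 * Real.pi) ^ ((Module.finrank ℝ E : ℝ) / 2) : ℝ) : ℂ) := by
      rw [Complex.ofReal_cpow (by positivity)]
      push_cast
      congr 1
      ring
    rw [this, ← Complex.ofReal_mul, ← Real.rpow_add (by positivity)]
    simp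
  rw [e2, one_mul, Complex.I_sq]
  congr 1
  ring

theorem stdGaussian_absolutelyContinuous : stdGaussian E ≪ (volume : Measure E) := by
  rw [stdGaussian_eq_withDensity]
  exact withDensity_absolutelyContinuous _ _

theorem integral_stdGaussian (φ : E → ℝ) :
    ∫ x, φ x ∂stdGaussian E = ∫ x, gaussDensity x * φ x := by
  rw [stdGaussian_eq_withDensity, integral_withDensity_eq_integral_toReal_smul
    continuous_gaussDensity.measurable.ennreal_ofReal (by simp)]
  simp [ENNReal.toReal_ofReal (gaussDensity_pos _).le]

/-- Total variation bound between two translates of the standard Gaussian measure. -/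
theorem integral_abs_gaussDensity_sub_le (u : E) :
    ∫ x : E, |gaussDensity (x - u) - gaussDensity x| ≤ ‖u‖ := by
  rcases eq_or_ne u 0 with rfl | hu
  · simp
  have hv : 0 < ‖u‖ := norm_pos_iff.2 hu
  have i0 := integrable_gaussDensity (E := E)
  have i1 : Integrable fun x : E => gaussDensity (x - u) := i0.comp_sub_right u
  have i2 : Integrable fun x : E => gaussDensity (x - (1 / 2 : ℝ) • u) := i0.comp_sub_right _
  have j1 : ∫ x : E, gaussDensity (x - u) = 1 := by
    rw [integral_sub_right_eq_self (fun x : E => gaussDensity x), integral_gaussDensity]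
  have j2 : ∫ x : E, gaussDensity (x - (1 / 2 : ℝ) • u) = 1 := by
    rw [integral_sub_right_eq_self (fun x : E => gaussDensity x), integral_gaussDensity]
  set ρ := Real.exp (-(‖u‖ ^ 2 / 8)) with hρ
  -- With p, q the square roots of the two densities, |p² - q²| ≤ a(p - q)² + b(p + q)² whenever 4ab
  -- = 1. The squares integrate to 2(1 - ρ) ≤ ‖u‖²/4 and 2(1 + ρ) ≤ 4, so these weights make each
  -- term at most ‖u‖/2.
  set a : ℝ := 2 / ‖u‖ with ha
  set b : ℝ := ‖u‖ / 8 with hb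
  have hab : 4 * a * b = 1 := by rw [ha, hb]; field_simp; norm_num
  have ha0 : 0 < a := by positivity
  have hb0 : 0 < b := by positivity
  have key : ∀ x : E, |gaussDensity (x - u) - gaussDensity x| ≤
      (a + b) * (gaussDensity (x - u) + gaussDensity x) +
        2 * (b - a) * ρ * gaussDensity (x - (1 / 2 : ℝ) • u) := by
    intro x
    have h1 := Real.sq_sqrt (gaussDensity_pos (x - u)).le
    have h2 := Real.sq_sqrt (gaussDensity_pos x).le
    have h3 := sqrt_gaussDensity_mul u x
    set p := √(gaussDensity (x - u))
    set q := √(gaussDensity x)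
    have hr : (a + b) * (gaussDensity (x - u) + gaussDensity x) +
        2 * (b - a) * ρ * gaussDensity (x - (1 / 2 : ℝ) • u) =
        a * (p - q) ^ 2 + b * (p + q) ^ 2 := by
      rw [← h1, ← h2]
      linear_combination (-2 * (b - a)) * h3
    rw [hr, ← h1, ← h2, abs_le]
    have e : p ^ 2 - q ^ 2 = 4 * a * b * ((p - q) * (p + q)) := by rw [hab]; ring
    constructor
    · nlinarith [mul_nonneg hb0.le (sq_nonneg (2 * a * (p - q) + (p + q)))]
    · nlinarith [mul_nonneg hb0.le (sq_nonneg (2 * a * (p - q) - (p + q)))]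
  have i3 : Integrable fun x : E => gaussDensity (x - u) + gaussDensity x := i1.add i0
  refine (integral_mono (by exact (i1.sub i0).abs)
    (by exact (i3.const_mul (a + b)).add (i2.const_mul (2 * (b - a) * ρ))) key).trans ?_
  rw [integral_add (i3.const_mul (a + b)) (i2.const_mul _), integral_const_mul,
    integral_const_mul, integral_add i1 i0, j1, j2, integral_gaussDensity]
  have hρ1 : 1 - ‖u‖ ^ 2 / 8 ≤ ρ := by
    have := Real.add_one_le_exp (-(‖u‖ ^ 2 / 8))
    linarith
  have hρ2 : ρ ≤ 1 := Real.exp_le_one_iff.2 (by have := sq_nonneg ‖u‖; linarith)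
  have h1 : a * (1 - ρ) ≤ ‖u‖ / 4 := by
    calc a * (1 - ρ) ≤ a * (‖u‖ ^ 2 / 8) := by gcongr; linarith
      _ = ‖u‖ / 4 := by rw [ha]; field_simp; norm_num
  have h2 : b * (1 + ρ) ≤ ‖u‖ / 4 := by
    calc b * (1 + ρ) ≤ b * 2 := by gcongr; linarith
      _ = ‖u‖ / 4 := by rw [hb]; ring
  linarith

/-- The expectation of a bounded function is Lipschitz in the mean of the Gaussian. -/
theorem abs_integral_stdGaussian_shift_le {φ : E → ℝ} (hφ : Measurable φ) {M : ℝ}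
    (hM : ∀ x, |φ x| ≤ M) (u : E) :
    |∫ x, φ (x + u) ∂stdGaussian E - ∫ x, φ x ∂stdGaussian E| ≤ M * ‖u‖ := by
  have i0 := integrable_gaussDensity (E := E)
  have i1 : Integrable fun x : E => gaussDensity (x - u) := i0.comp_sub_right u
  have hM0 : 0 ≤ M := (abs_nonneg _).trans (hM 0)
  have e : ∫ x, φ (x + u) ∂stdGaussian E = ∫ x : E, gaussDensity (x - u) * φ x := by
    rw [integral_stdGaussian,
      ← integral_add_right_eq_self (fun x : E => gaussDensity (x - u) * φ x) u]
    simp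
  have hb : ∀ᵐ x : E, ‖φ x‖ ≤ M := .of_forall hM
  rw [e, integral_stdGaussian, ← integral_sub
    (i1.mul_bdd hφ.aestronglyMeasurable hb) (i0.mul_bdd hφ.aestronglyMeasurable hb)]
  refine abs_integral_le_integral_abs.trans ?_
  calc ∫ x : E, |gaussDensity (x - u) * φ x - gaussDensity x * φ x|
      ≤ ∫ x : E, M * |gaussDensity (x - u) - gaussDensity x| := by
        refine integral_mono ((i1.mul_bdd hφ.aestronglyMeasurable hb).sub
          (i0.mul_bdd hφ.aestronglyMeasurable hb)).abs ((i1.sub i0).abs.const_mul M) fun x => ?_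
        simp only [← sub_mul, abs_mul]
        rw [mul_comm]
        gcongr
        exact hM x
    _ ≤ M * ‖u‖ := by
        rw [integral_const_mul]
        gcongr
        exact integral_abs_gaussDensity_sub_le u

theorem integral_norm_sq_stdGaussian :
    ∫ x, ‖x‖ ^ 2 ∂stdGaussian E = Module.finrank ℝ E := by
  let b := stdOrthonormalBasis ℝ E
  have h : ∀ x : E, ‖x‖ ^ 2 = ∑ i, (innerSL ℝ (b i) x) ^ 2 := fun x => by
    simpa [Real.norm_eq_abs, sq_abs] using (b.sum_sq_norm_inner_right x).symm
  have hL : ∀ i, MemLp (innerSL ℝ (b i)) 2 (stdGaussian E) := fun i =>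
    IsGaussian.memLp_dual _ _ _ (by simp)
  simp_rw [h]
  rw [integral_finsetSum _ fun i _ => (hL i).integrable_sq]
  have : ∀ i, ∫ x, (innerSL ℝ (b i) x) ^ 2 ∂stdGaussian E = 1 := fun i => by
    have hv := variance_dual_stdGaussian (innerSL ℝ (b i))
    rw [variance_of_integral_eq_zero (hL i).aemeasurable
      (integral_strongDual_stdGaussian _)] at hv
    rw [hv, innerSL_apply_norm, b.norm_eq_one, one_pow]
  rw [Finset.sum_congr rfl fun i _ => this i]
  simp

theorem integrable_norm_stdGaussian : Integrable (fun x : E => ‖x‖) (stdGaussian E) :=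
  IsGaussian.integrable_id.norm

theorem integral_norm_stdGaussian_le :
    ∫ x, ‖x‖ ∂stdGaussian E ≤ √(Module.finrank ℝ E) := by
  have h2 : MemLp (fun x : E => ‖x‖) 2 (stdGaussian E) := IsGaussian.memLp_two_id.norm
  refine Real.le_sqrt_of_sq_le ?_
  rw [← integral_norm_sq_stdGaussian]
  have := variance_nonneg (fun x : E => ‖x‖) (stdGaussian E)
  rw [variance_eq_sub h2] at this
  simpa using this

end Gaussian

/-! ### Gaussian smoothing -/

section Smoothing

theorem continuous_of_abs_sub_le {E : Type*} [NormedAddCommGroup E] {f : E → ℝ} {L : ℝ}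
    (hf : ∀ x y, |f x - f y| ≤ L * ‖x - y‖) :
    Continuous f := by
  have : LipschitzWith (Real.toNNReal L) f := LipschitzWith.of_dist_le_mul fun x y => by
    rw [Real.dist_eq, dist_eq_norm]
    exact (hf x y).trans (by gcongr; exact Real.le_coe_toNNReal L)
  exact this.continuous

variable {E : Type*} [NormedAddCommGroup E] [InnerProductSpace ℝ E]

/-- Test the subgradient inequality at θ + v. The local oracles may be unbounded; only their average
inherits a bound in this way. -/
theorem norm_subgradient_le {f : E → ℝ} {L : ℝ} (hf : ∀ x y, |f x - f y| ≤ L * ‖x - y‖) (hL : 0 ≤ L)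
    {v θ : E}
    (h : ∀ x, f θ + inner ℝ v (x - θ) ≤ f x) : ‖v‖ ≤ L := by
  have h1 := h (θ + v)
  have h2 := (le_abs_self _).trans (hf (θ + v) θ)
  rw [add_sub_cancel_left, real_inner_self_eq_norm_sq] at h1
  rw [add_sub_cancel_left] at h2
  rcases (norm_nonneg v).eq_or_lt with h0 | h0
  · rwa [← h0]
  · nlinarith

variable [FiniteDimensional ℝ E] [MeasurableSpace E] [BorelSpace E]

/-- A property that holds almost everywhere holds almost surely at a Gaussian perturbation. -/
theorem ae_stdGaussian_of_ae {p : E → Prop} (hp : ∀ᵐ θ, p θ) {γ : ℝ} (hγ : γ ≠ 0) (y : E) :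
    ∀ᵐ w ∂stdGaussian E, p (y + γ • w) := by
  refine stdGaussian_absolutelyContinuous.ae_le ?_
  have h1 : ∀ᵐ θ, p (y + θ) :=
    (measurePreserving_add_left (volume : Measure E) y).quasiMeasurePreserving.ae hp
  have h2 : Measure.QuasiMeasurePreserving (fun w : E => γ • w) volume volume :=
    ⟨by fun_prop, by
      rw [Measure.map_addHaar_smul _ hγ]
      exact Measure.AbsolutelyContinuous.rfl.smul_left _⟩
  exact h2.ae h1

/-- Gaussian smoothing of a function. -/
noncomputable def smooth (f : E → ℝ) (γ : ℝ) (x : E) : ℝ :=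
  ∫ w, f (x + γ • w) ∂stdGaussian E

/-- The expectation of an oracle at a Gaussian perturbation. -/
noncomputable def smoothGrad (s : E → E) (γ : ℝ) (x : E) : E :=
  ∫ w, s (x + γ • w) ∂stdGaussian E

variable {f : E → ℝ} {L : ℝ}

theorem integrable_smooth (hf : ∀ x y, |f x - f y| ≤ L * ‖x - y‖) (γ : ℝ) (x : E) :
    Integrable (fun w => f (x + γ • w)) (stdGaussian E) := by
  have hc := continuous_of_abs_sub_le hf
  refine Integrable.mono' ((integrable_const |f x|).add
    (integrable_norm_stdGaussian.const_mul (L * |γ|)))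
    (by fun_prop) (.of_forall fun w => ?_)
  have h := hf (x + γ • w) x
  rw [add_sub_cancel_left, norm_smul, Real.norm_eq_abs, ← mul_assoc] at h
  have h2 := abs_sub_abs_le_abs_sub (f (x + γ • w)) (f x)
  simp only [Pi.add_apply, Real.norm_eq_abs]
  linarith

theorem smooth_le (hf : ∀ x y, |f x - f y| ≤ L * ‖x - y‖) (hL : 0 ≤ L) {γ : ℝ} (hγ : 0 ≤ γ)
    (x : E) : smooth f γ x ≤ f x + L * γ * √(Module.finrank ℝ E) := by
  calc smooth f γ x ≤ ∫ w, (f x + L * γ * ‖w‖) ∂stdGaussian E := by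
        refine integral_mono (integrable_smooth hf γ x)
          ((integrable_const _).add (integrable_norm_stdGaussian.const_mul _)) fun w => ?_
        have h := (le_abs_self _).trans (hf (x + γ • w) x)
        rw [add_sub_cancel_left, norm_smul, Real.norm_eq_abs, abs_of_nonneg hγ, ← mul_assoc] at h
        simp only
        linarith
    _ = f x + L * γ * ∫ w, ‖w‖ ∂stdGaussian E := by
        rw [integral_add (integrable_const _) (integrable_norm_stdGaussian.const_mul _),
          integral_const_mul]
        simp
    _ ≤ _ := by gcongr; exact integral_norm_stdGaussian_le

/-- Jensen's inequality, the Gaussian being centred. -/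
theorem le_smooth (hc : ConvexOn ℝ Set.univ f) (hf : ∀ x y, |f x - f y| ≤ L * ‖x - y‖)
    (γ : ℝ) (x : E) : f x ≤ smooth f γ x := by
  have hi : Integrable (fun w : E => w) (stdGaussian E) := IsGaussian.integrable_id
  have h := hc.map_integral_le (μ := stdGaussian E) (f := fun w : E => x + γ • w)
    (continuous_of_abs_sub_le hf).continuousOn isClosed_univ (.of_forall fun _ => Set.mem_univ _)
    ((integrable_const x).add (hi.smul γ)) (integrable_smooth hf γ x)
  have e : ∫ w, (x + γ • w) ∂stdGaussian E = x := by
    rw [integral_add (integrable_const x) (by exact hi.smul γ), integral_smul]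
    simp
  rwa [e] at h

/-- Smoothing a convex function with a larger radius increases it. -/
theorem smooth_mono (hc : ConvexOn ℝ Set.univ f) (hf : ∀ x y, |f x - f y| ≤ L * ‖x - y‖)
    {γ γ' : ℝ} (h0 : 0 ≤ γ') (hγ : γ' ≤ γ) (x : E) : smooth f γ' x ≤ smooth f γ x := by
  rcases h0.eq_or_lt with rfl | h0
  · simpa [smooth] using le_smooth hc hf γ x
  have hpos : 0 < γ := h0.trans_le hγ
  set c := γ' / γ with hcdef
  have hc0 : 0 ≤ c := by positivity
  have hc1 : 0 ≤ 1 - c := sub_nonneg.2 ((div_le_one hpos).2 hγ)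
  -- The point x + γ'w lies on the segment from x to x + γw. The weight left on f x is then absorbed
  -- by `le_smooth`.
  have h1 : smooth f γ' x ≤ (1 - c) * f x + c * smooth f γ x := by
    have hi := integrable_smooth hf γ x
    calc smooth f γ' x ≤ ∫ w, ((1 - c) * f x + c * f (x + γ • w)) ∂stdGaussian E := by
          refine integral_mono (integrable_smooth hf γ' x)
            ((integrable_const _).add (hi.const_mul c)) fun w => ?_
          have h := hc.2 (Set.mem_univ x) (Set.mem_univ (x + γ • w)) hc1 hc0 (by ring)
          have e : (1 - c) • x + c • (x + γ • w) = x + γ' • w := by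
            rw [smul_add, smul_smul, show c * γ = γ' by rw [hcdef]; field_simp]
            module
          rw [e] at h
          simpa using h
      _ = _ := by
          rw [integral_add (integrable_const _) (hi.const_mul c),
            integral_const_mul c]
          simp [smooth]
  have h2 := mul_le_mul_of_nonneg_left (le_smooth hc hf γ x) hc1
  linarith

variable {s : E → E}

theorem integrable_oracle {M : ℝ} (hsm : Measurable s) (hsb : ∀ θ, ‖s θ‖ ≤ M) (γ : ℝ) (x : E) :
    Integrable (fun w => s (x + γ • w)) (stdGaussian E) :=
  Integrable.of_bound
    (hsm.comp (by fun_prop : Measurable fun w : E => x + γ • w)).aestronglyMeasurable M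
    (.of_forall fun _ => hsb _)

theorem norm_smoothGrad_le {M : ℝ} (hsb : ∀ θ, ‖s θ‖ ≤ M) (γ : ℝ) (x : E) :
    ‖smoothGrad s γ x‖ ≤ M := by
  simpa [smoothGrad] using
    norm_integral_le_of_norm_le_const (μ := stdGaussian E) (.of_forall fun w => hsb (x + γ • w))

theorem measurable_smoothGrad (hsm : Measurable s) (γ : ℝ) : Measurable (smoothGrad s γ) := by
  have h : StronglyMeasurable (Function.uncurry fun (x w : E) => s (x + γ • w)) :=
    (hsm.comp (by fun_prop : Measurable fun p : E × E => p.1 + γ • p.2)).stronglyMeasurable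
  exact h.integral_prod_right.measurable

theorem inner_smoothGrad {M : ℝ} (hsm : Measurable s) (hsb : ∀ θ, ‖s θ‖ ≤ M) (γ : ℝ) (x v : E) :
    inner ℝ (smoothGrad s γ x) v = ∫ w, inner ℝ (s (x + γ • w)) v ∂stdGaussian E := by
  rw [real_inner_comm, smoothGrad, ← integral_inner (integrable_oracle hsm hsb γ x)]
  simp_rw [real_inner_comm]

/-- Integrate the subgradient inequality at y + γw towards x + γw: the displacement x - y does not
depend on w. -/
theorem smooth_add_inner_le (hf : ∀ x y, |f x - f y| ≤ L * ‖x - y‖) (hsm : Measurable s)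
    (hsb : ∀ θ, ‖s θ‖ ≤ L) (hs : ∀ᵐ θ, ∀ x, f θ + inner ℝ (s θ) (x - θ) ≤ f x)
    {γ : ℝ} (hγ : γ ≠ 0) (y x : E) :
    smooth f γ y + inner ℝ (smoothGrad s γ y) (x - y) ≤ smooth f γ x := by
  have hi : Integrable (fun w => inner ℝ (s (y + γ • w)) (x - y)) (stdGaussian E) :=
    (integrable_oracle hsm hsb γ y).inner_const _
  rw [inner_smoothGrad hsm hsb, smooth, ← integral_add (integrable_smooth hf γ y) hi]
  refine integral_mono_ae ((integrable_smooth hf γ y).add hi) (integrable_smooth hf γ x) ?_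
  filter_upwards [ae_stdGaussian_of_ae hs hγ y] with w hw
  simpa using hw (x + γ • w)

/-- No differentiability is needed. The subgradient inequality at y + h bounds the increase by the
averaged oracle at y + h paired with h. Moving the base point back to y shifts the Gaussian by h/γ
under an integrand bounded by L‖h‖, which costs L‖h‖²/γ. -/
theorem smooth_add_le (hf : ∀ x y, |f x - f y| ≤ L * ‖x - y‖) (hsm : Measurable s)
    (hsb : ∀ θ, ‖s θ‖ ≤ L) (hs : ∀ᵐ θ, ∀ x, f θ + inner ℝ (s θ) (x - θ) ≤ f x)
    {γ : ℝ} (hγ : 0 < γ) (y h : E) :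
    smooth f γ (y + h) ≤ smooth f γ y + inner ℝ (smoothGrad s γ y) h + L / γ * ‖h‖ ^ 2 := by
  have h1 := smooth_add_inner_le hf hsm hsb hs hγ.ne' (y + h) y
  have hφ : Measurable fun w => inner ℝ (s (y + γ • w)) h :=
    (hsm.comp (by fun_prop : Measurable fun w : E => y + γ • w)).inner_const
  have h2 := abs_integral_stdGaussian_shift_le hφ (M := L * ‖h‖)
    (fun w => (abs_real_inner_le_norm _ _).trans (by gcongr; exact hsb _)) (γ⁻¹ • h)
  have e : ∀ w : E, y + γ • (w + γ⁻¹ • h) = y + h + γ • w := fun w => by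
    rw [smul_add, smul_inv_smul₀ hγ.ne']
    abel
  simp only [e] at h2
  rw [← inner_smoothGrad hsm hsb, ← inner_smoothGrad hsm hsb, norm_smul, norm_inv,
    Real.norm_eq_abs, abs_of_pos hγ] at h2
  have h3 := (le_abs_self _).trans h2
  rw [sub_add_cancel_left, inner_neg_right] at h1
  have h4 : L * ‖h‖ * (γ⁻¹ * ‖h‖) = L / γ * ‖h‖ ^ 2 := by ring
  linarith

end Smoothing

/-- Fréchet subgradients at a common point can be averaged without any convexity; convexity of the
average alone later makes the inequality global. -/
theorem isSubgradientAt_avg {V : Type*} [Fintype V] {d : ℕ} {f : V → Vec d → ℝ}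
    {g : V → Vec d → Vec d} {θ : Vec d} (h : ∀ i, IsSubgradientAt (f i) (g i θ) θ) :
    IsSubgradientAt (avg f) (avgOracle g θ) θ := by
  intro c hc
  have h1 : ∀ᶠ x in 𝓝 θ, ∀ i, f i θ + inner ℝ (g i θ) (x - θ) - c * ‖x - θ‖ ≤ f i x :=
    Filter.eventually_all.2 fun i => h i c hc
  filter_upwards [h1] with x hx
  have hcard : (1 / (Fintype.card V : ℝ)) * Fintype.card V ≤ 1 := by
    rcases eq_or_ne (Fintype.card V : ℝ) 0 with h0 | h0
    · simp [h0]
    · rw [one_div, inv_mul_cancel₀ h0]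
  have hsum := mul_le_mul_of_nonneg_left (Finset.sum_le_sum fun i (_ : i ∈ Finset.univ) => hx i)
    (by positivity : 0 ≤ 1 / (Fintype.card V : ℝ))
  rw [Finset.sum_sub_distrib, Finset.sum_add_distrib, Finset.sum_const, Finset.card_univ,
    nsmul_eq_mul, ← sum_inner] at hsum
  have hc2 := mul_le_mul_of_nonneg_right hcard (by positivity : 0 ≤ c * ‖x - θ‖)
  simp only [avg, avgOracle, real_inner_smul_left]
  linarith

/-! ### The step parameters -/

theorem alpha_pos (t : ℕ) : 0 < alpha t := by
  cases t with
  | zero => exact one_pos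
  | succ t => rw [alpha]; positivity

theorem inv_alpha_succ (t : ℕ) : (alpha (t + 1))⁻¹ = (1 + √(1 + 4 * (alpha t)⁻¹ ^ 2)) / 2 := by
  rw [alpha, inv_div, inv_pow, div_eq_mul_inv 4]

/-- The recursion for `alpha` is the positive root of this quadratic equation, which makes the sum
of the weights 1/α_t telescope. -/
theorem inv_alpha_succ_sq (t : ℕ) :
    (alpha (t + 1))⁻¹ ^ 2 = (alpha (t + 1))⁻¹ + (alpha t)⁻¹ ^ 2 := by
  have h := Real.sq_sqrt (by positivity : 0 ≤ 1 + 4 * (alpha t)⁻¹ ^ 2)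
  rw [inv_alpha_succ]
  linear_combination (1 / 4) * h

theorem inv_alpha_succ_ge (t : ℕ) : (alpha t)⁻¹ + 1 / 2 ≤ (alpha (t + 1))⁻¹ := by
  have h0 := inv_pos.2 (alpha_pos t)
  have h : 2 * (alpha t)⁻¹ ≤ √(1 + 4 * (alpha t)⁻¹ ^ 2) := Real.le_sqrt_of_sq_le (by nlinarith)
  rw [inv_alpha_succ]
  linarith

theorem inv_alpha_succ_le (t : ℕ) : (alpha (t + 1))⁻¹ ≤ (alpha t)⁻¹ + 1 := by
  have h0 := inv_pos.2 (alpha_pos t)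
  have h : √(1 + 4 * (alpha t)⁻¹ ^ 2) ≤ 1 + 2 * (alpha t)⁻¹ :=
    Real.sqrt_le_iff.2 ⟨by positivity, by nlinarith⟩
  rw [inv_alpha_succ]
  linarith

theorem le_inv_alpha (t : ℕ) : ((t : ℝ) + 2) / 2 ≤ (alpha t)⁻¹ := by
  induction t with
  | zero => simp [alpha]
  | succ t ih => have := inv_alpha_succ_ge t; push_cast; linarith

theorem inv_alpha_le (t : ℕ) : (alpha t)⁻¹ ≤ t + 1 := by
  induction t with
  | zero => simp [alpha]
  | succ t ih => have := inv_alpha_succ_le t; push_cast; linarith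

theorem alpha_le_one (t : ℕ) : alpha t ≤ 1 := by
  have h := le_inv_alpha t
  have h1 : 1 ≤ (alpha t)⁻¹ := by
    have : (0 : ℝ) ≤ t := t.cast_nonneg
    linarith
  exact (one_le_inv₀ (alpha_pos t)).1 h1

theorem alpha_succ_le (t : ℕ) : alpha (t + 1) ≤ alpha t := by
  have h := inv_alpha_succ_ge t
  exact (inv_le_inv₀ (alpha_pos t) (alpha_pos _)).1 (by linarith)

theorem sum_inv_alpha (t : ℕ) : ∑ s ∈ Finset.range (t + 1), (alpha s)⁻¹ = (alpha t)⁻¹ ^ 2 := by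
  induction t with
  | zero => simp [alpha]
  | succ t ih => rw [Finset.sum_range_succ, ih, inv_alpha_succ_sq, add_comm]

/-! ### The projection step -/

section Argmin

variable {d : ℕ} {S : Set (Vec d)}

/-- A minimizer is a nearest point of S to -w, which exists because S is closed; hence the arbitrary
choice in `argminOn` is a true minimizer. -/
theorem argminOn_spec (hcl : IsClosed S) (hne : S.Nonempty) (w : Vec d) :
    (argminOn S fun x => ‖x + w‖ ^ 2) ∈ S ∧
      IsMinOn (fun x => ‖x + w‖ ^ 2) S (argminOn S fun x => ‖x + w‖ ^ 2) := by
  refine Classical.epsilon_spec (p := fun x => x ∈ S ∧ IsMinOn (fun x => ‖x + w‖ ^ 2) S x) ?_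
  obtain ⟨p, hp, h⟩ := hcl.exists_infDist_eq_dist hne (-w)
  refine ⟨p, hp, fun u hu => ?_⟩
  have h1 := Metric.infDist_le_dist_of_mem (x := -w) hu
  rw [h, dist_comm, dist_comm (-w), dist_eq_norm, dist_eq_norm, sub_neg_eq_add,
    sub_neg_eq_add] at h1
  simp only [Set.mem_ofPred_eq]
  gcongr

theorem argminOn_add_sq_le (hcv : Convex ℝ S) (hcl : IsClosed S) (hne : S.Nonempty) (w : Vec d)
    {u : Vec d} (hu : u ∈ S) :
    ‖(argminOn S fun x => ‖x + w‖ ^ 2) + w‖ ^ 2 +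
      ‖u - argminOn S fun x => ‖x + w‖ ^ 2‖ ^ 2 ≤ ‖u + w‖ ^ 2 := by
  obtain ⟨hp, hmin⟩ := argminOn_spec hcl hne w
  set p := argminOn S fun x => ‖x + w‖ ^ 2
  -- First-order optimality: compare p with p + c(u - p), divide by c, and let c tend to 0.
  have key : ∀ c : ℝ, 0 < c → c ≤ 1 →
      0 ≤ 2 * inner ℝ (p + w) (u - p) + c * ‖u - p‖ ^ 2 := by
    intro c h0 h1
    have hm := hmin (hcv.add_smul_sub_mem hp hu ⟨h0.le, h1⟩)
    simp only [Set.mem_ofPred_eq] at hm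
    rw [show p + c • (u - p) + w = (p + w) + c • (u - p) by abel,
      norm_add_sq_real (p + w), real_inner_smul_right, norm_smul, mul_pow,
      Real.norm_eq_abs, sq_abs] at hm
    have : 0 ≤ c * (2 * inner ℝ (p + w) (u - p) + c * ‖u - p‖ ^ 2) := by linarith
    exact nonneg_of_mul_nonneg_right this h0
  have hin : 0 ≤ 2 * inner ℝ (p + w) (u - p) := by
    have ht : Filter.Tendsto (fun c : ℝ => 2 * inner ℝ (p + w) (u - p) + c * ‖u - p‖ ^ 2)
        (𝓝[>] 0) (𝓝 (2 * inner ℝ (p + w) (u - p) + 0 * ‖u - p‖ ^ 2)) :=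
      (Continuous.tendsto (by fun_prop) 0).mono_left nhdsWithin_le_nhds
    rw [zero_mul, add_zero] at ht
    refine ge_of_tendsto ht ?_
    filter_upwards [self_mem_nhdsWithin, nhdsWithin_le_nhds (Iic_mem_nhds one_pos)] with c h0 h1
    exact key c h0 h1
  rw [show u + w = (p + w) + (u - p) by abel, norm_add_sq_real (p + w)]
  linarith

/-- Adding the two strong minimality inequalities shows that the projection is nonexpansive.
Continuity serves to make the iterates measurable. -/
theorem continuous_argminOn (hcv : Convex ℝ S) (hcl : IsClosed S) (hne : S.Nonempty) :
    Continuous fun w : Vec d => argminOn S fun x => ‖x + w‖ ^ 2 := by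
  refine LipschitzWith.continuous (K := 1) (LipschitzWith.of_dist_le_mul fun v w => ?_)
  have h1 := argminOn_add_sq_le hcv hcl hne v (argminOn_spec hcl hne w).1
  have h2 := argminOn_add_sq_le hcv hcl hne w (argminOn_spec hcl hne v).1
  set p := argminOn S fun x => ‖x + v‖ ^ 2
  set q := argminOn S fun x => ‖x + w‖ ^ 2
  rw [NNReal.coe_one, one_mul, dist_eq_norm, dist_eq_norm]
  rw [norm_add_sq_real, norm_add_sq_real, norm_sub_rev] at h1
  rw [norm_add_sq_real, norm_add_sq_real] at h2
  have h3 : inner ℝ (q - p) (v - w) ≤ ‖p - q‖ * ‖v - w‖ := by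
    rw [norm_sub_rev p q]
    exact real_inner_le_norm _ _
  simp only [inner_sub_left, inner_sub_right] at h3
  rcases (norm_nonneg (p - q)).eq_or_lt with h0 | h0
  · rw [← h0]; positivity
  · nlinarith

/-- Optimality of the dual averaging step. -/
theorem argminOn_dual_averaging (hcv : Convex ℝ S) (hcl : IsClosed S) (hne : S.Nonempty)
    {η : ℝ} (hη : 0 < η) (G : Vec d) {u : Vec d} (hu : u ∈ S) :
    inner ℝ G (argminOn S fun x => ‖x + η • G‖ ^ 2) +
        η⁻¹ / 2 * ‖argminOn S fun x => ‖x + η • G‖ ^ 2‖ ^ 2 +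
        η⁻¹ / 2 * ‖u - argminOn S fun x => ‖x + η • G‖ ^ 2‖ ^ 2 ≤
      inner ℝ G u + η⁻¹ / 2 * ‖u‖ ^ 2 := by
  have h := argminOn_add_sq_le hcv hcl hne (η • G) hu
  set p := argminOn S fun x => ‖x + η • G‖ ^ 2
  rw [norm_add_sq_real, norm_add_sq_real, real_inner_smul_right, real_inner_smul_right,
    real_inner_comm, real_inner_comm G u] at h
  have h2 := mul_le_mul_of_nonneg_left h (by positivity : 0 ≤ η⁻¹ / 2)
  have e : η⁻¹ * η = 1 := inv_mul_cancel₀ hη.ne'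
  have e1 : η⁻¹ * (η * inner ℝ G p) = inner ℝ G p := by rw [← mul_assoc, e, one_mul]
  have e2 : η⁻¹ * (η * inner ℝ G u) = inner ℝ G u := by rw [← mul_assoc, e, one_mul]
  linarith

end Argmin

/-! ### Accelerated dual averaging with inexact gradients -/

section DualAveraging

variable {E : Type*} [NormedAddCommGroup E] [InnerProductSpace ℝ E]

/-- Deterministic error bound of accelerated dual averaging with gradient estimates `gh t` in place
of `m t` and slowly decreasing objective functions `F t`. -/
theorem accelerated_dual_averaging_le {S : Set E} {x y z G gh m : ℕ → E} {F : ℕ → E → ℝ}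
    {β Λ c : ℕ → ℝ} (hz0 : z 0 = 0) (hG0 : G 0 = 0)
    (hy : ∀ t, y t = (1 - alpha t) • x t + alpha t • z t)
    (hG : ∀ t, G (t + 1) = G t + (alpha t)⁻¹ • gh t)
    (hx : ∀ t, x (t + 1) = (1 - alpha t) • x t + alpha t • z (t + 1))
    (hzS : ∀ t, z t ∈ S)
    (hz : ∀ t, ∀ u ∈ S, inner ℝ (G t) (z t) + β t / 2 * ‖z t‖ ^ 2 + β t / 2 * ‖u - z t‖ ^ 2 ≤
      inner ℝ (G t) u + β t / 2 * ‖u‖ ^ 2)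
    (hβ0 : ∀ t, 0 ≤ β t) (hβ : ∀ t, β t ≤ β (t + 1))
    (hF1 : ∀ t, F t (x (t + 1)) ≤
      F t (y t) + inner ℝ (m t) (x (t + 1) - y t) + Λ t * ‖x (t + 1) - y t‖ ^ 2)
    (hF2 : ∀ t u, F t (y t) + inner ℝ (m t) (u - y t) ≤ F t u)
    (hF3 : ∀ t u, F (t + 1) u ≤ F t u)
    (hc : ∀ t, 0 < c t) (hcβ : ∀ t, Λ t + c t / 2 ≤ β t / 2) {θ : E} (hθ : θ ∈ S) (T : ℕ) :
    (∑ t ∈ Finset.range T, (alpha t)⁻¹) * F (T - 1) (x T) ≤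
      ∑ t ∈ Finset.range T, ((alpha t)⁻¹ * (F t θ + inner ℝ (gh t - m t) (θ - z t)) +
        (alpha t)⁻¹ ^ 2 * ‖gh t - m t‖ ^ 2 / (2 * c t)) + β T / 2 * ‖θ‖ ^ 2 := by
  -- Estimate sequence: the right side is the value at z T of the accumulated linear models F t (y
  -- t) + ⟨m t, · - y t⟩ + ⟨gh t - m t, · - z t⟩ with weights 1/α_t, plus the regularizer and a
  -- noise allowance.
  have hinv : ∀ T, (∑ t ∈ Finset.range T, (alpha t)⁻¹) * F (T - 1) (x T) ≤
      ∑ t ∈ Finset.range T, ((alpha t)⁻¹ * (F t (y t) - inner ℝ (m t) (y t) -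
        inner ℝ (gh t - m t) (z t)) + (alpha t)⁻¹ ^ 2 * ‖gh t - m t‖ ^ 2 / (2 * c t)) +
        (inner ℝ (G T) (z T) + β T / 2 * ‖z T‖ ^ 2) := by
    intro T
    induction T with
    | zero => simp [hz0]
    | succ t ih =>
      -- For t = 0 truncated subtraction makes both sides equal.
      have hF3' : F t (x t) ≤ F (t - 1) (x t) := by
        cases t with
        | zero => exact le_rfl
        | succ t => exact hF3 t _
      have ha := alpha_pos t
      have hap : alpha t * (alpha t)⁻¹ = 1 := mul_inv_cancel₀ ha.ne'
      have hQ : ∑ s ∈ Finset.range t, (alpha s)⁻¹ = (alpha t)⁻¹ ^ 2 - (alpha t)⁻¹ := by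
        rw [← sum_inv_alpha, Finset.sum_range_succ, add_sub_cancel_right]
      have hQ0 : 0 ≤ ∑ s ∈ Finset.range t, (alpha s)⁻¹ :=
        Finset.sum_nonneg fun s _ => (inv_pos.2 (alpha_pos s)).le
      rw [sum_inv_alpha, Finset.sum_range_succ, Nat.add_sub_cancel]
      set a := alpha t
      set p := a⁻¹
      have hp : 0 < p := inv_pos.2 ha
      have hd : x (t + 1) - y t = a • (z (t + 1) - z t) := by rw [hx, hy]; module
      have h1 := mul_le_mul_of_nonneg_left (hF1 t) (sq_nonneg p)
      have h2 := mul_le_mul_of_nonneg_left ((hF2 t (x t)).trans hF3') hQ0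
      have hnorm : p ^ 2 * ‖x (t + 1) - y t‖ ^ 2 = ‖z (t + 1) - z t‖ ^ 2 := by
        rw [hd, norm_smul, Real.norm_eq_abs, abs_of_pos ha, mul_pow, ← mul_assoc, ← mul_pow,
          mul_comm p a, hap, one_pow, one_mul]
      -- The coupling of x, y and z splits the step into x t - y t, carrying the weight accumulated
      -- so far, and z (t + 1) - y t, carrying the new weight p.
      have hin : p ^ 2 * inner ℝ (m t) (x (t + 1) - y t) =
          (p ^ 2 - p) * inner ℝ (m t) (x t - y t) + p * inner ℝ (m t) (z (t + 1) - y t) := by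
        have : p ^ 2 • (x (t + 1) - y t) = (p ^ 2 - p) • (x t - y t) + p • (z (t + 1) - y t) := by
          rw [hx]
          have e1 : p ^ 2 * (1 - a) = p ^ 2 - p := by linear_combination (-p) * hap
          have e2 : p ^ 2 * a = p := by linear_combination p * hap
          rw [smul_sub, smul_add, smul_smul, smul_smul, e1, e2]
          module
        rw [← real_inner_smul_right, this, inner_add_right, real_inner_smul_right,
          real_inner_smul_right]
      have h3 : p ^ 2 * F t (x (t + 1)) ≤ (∑ s ∈ Finset.range t, (alpha s)⁻¹) * F (t - 1) (x t) +
          p * (F t (y t) + inner ℝ (m t) (z (t + 1) - y t)) +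
          Λ t * ‖z (t + 1) - z t‖ ^ 2 := by
        rw [hQ] at h2 ⊢
        have : p ^ 2 * (Λ t * ‖x (t + 1) - y t‖ ^ 2) = Λ t * ‖z (t + 1) - z t‖ ^ 2 := by
          rw [← hnorm]; ring
        linarith
      -- The previous model is strongly convex and minimal at z t; the gain β t / 2 * ‖z (t + 1) - z
      -- t‖² pays for the curvature Λ t and for the Young term below.
      have h4 := hz t _ (hzS (t + 1))
      have hβz := mul_le_mul_of_nonneg_right (hβ t) (sq_nonneg ‖z (t + 1)‖)
      -- The noise must be paired with z t, which is independent of it, and not with z (t + 1);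
      -- Young's inequality pays for the difference.
      have hyoung : -(p * inner ℝ (gh t - m t) (z (t + 1) - z t)) ≤
          p ^ 2 * ‖gh t - m t‖ ^ 2 / (2 * c t) + c t / 2 * ‖z (t + 1) - z t‖ ^ 2 := by
        have hcs := neg_le_of_abs_le
          (abs_real_inner_le_norm (gh t - m t) (z (t + 1) - z t))
        have hcs' := mul_le_mul_of_nonneg_left hcs hp.le
        have hct := hc t
        have e : p ^ 2 * ‖gh t - m t‖ ^ 2 / (2 * c t) + c t / 2 * ‖z (t + 1) - z t‖ ^ 2 -
            p * (‖gh t - m t‖ * ‖z (t + 1) - z t‖) =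
            (p * ‖gh t - m t‖ - c t * ‖z (t + 1) - z t‖) ^ 2 / (2 * c t) := by
          field_simp
          ring
        have e2 : 0 ≤ (p * ‖gh t - m t‖ - c t * ‖z (t + 1) - z t‖) ^ 2 / (2 * c t) := by
          positivity
        linarith
      have hcz := mul_le_mul_of_nonneg_right (hcβ t) (sq_nonneg ‖z (t + 1) - z t‖)
      have hGz : inner ℝ (G (t + 1)) (z (t + 1)) =
          inner ℝ (G t) (z (t + 1)) + p * inner ℝ (gh t) (z (t + 1)) := by
        rw [hG, inner_add_left, real_inner_smul_left]
      simp only [inner_sub_right, inner_sub_left] at ih h3 hyoung ⊢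
      rw [hGz]
      linarith
  refine (hinv T).trans ?_
  -- Minimality of the final model at z T lets it be evaluated at θ, where each linearization lies
  -- below F t θ.
  have h5 := hz T θ hθ
  have hβT : 0 ≤ β T / 2 * ‖θ - z T‖ ^ 2 := by
    have := hβ0 T
    positivity
  have hGT : ∀ T, inner ℝ (G T) θ = ∑ t ∈ Finset.range T, (alpha t)⁻¹ * inner ℝ (gh t) θ := by
    intro T
    induction T with
    | zero => simp [hG0]
    | succ t ih => rw [hG, inner_add_left, real_inner_smul_left, ih, Finset.sum_range_succ]
  have h6 : ∑ t ∈ Finset.range T, ((alpha t)⁻¹ * (F t (y t) - inner ℝ (m t) (y t) -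
        inner ℝ (gh t - m t) (z t)) + (alpha t)⁻¹ ^ 2 * ‖gh t - m t‖ ^ 2 / (2 * c t)) +
        inner ℝ (G T) θ ≤
      ∑ t ∈ Finset.range T, ((alpha t)⁻¹ * (F t θ + inner ℝ (gh t - m t) (θ - z t)) +
        (alpha t)⁻¹ ^ 2 * ‖gh t - m t‖ ^ 2 / (2 * c t)) := by
    rw [hGT, ← Finset.sum_add_distrib]
    refine Finset.sum_le_sum fun t _ => ?_
    have h := mul_le_mul_of_nonneg_left (hF2 t θ) (inv_pos.2 (alpha_pos t)).le
    simp only [inner_sub_right, inner_sub_left] at h ⊢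
    linarith
  linarith

end DualAveraging

/-! ### The iterates as random variables -/

section Iterates

variable {d : ℕ} {S : Set (Vec d)} {s : Vec d → Vec d} {R L : ℝ} {K : ℕ}

/-- The point `y_t` around which the gradients of iteration `t` are sampled. -/
noncomputable def queryPoint (S : Set (Vec d)) (s : Vec d → Vec d) (R L : ℝ) (K : ℕ)
    (W : ℕ → ℕ → Vec d) (t : ℕ) : Vec d :=
  (1 - alpha t) • (stateVal S s R L K W t).x + alpha t • (stateVal S s R L K W t).z

/-- The gradient estimate of iteration `t`. -/
noncomputable def gradEstimate (S : Set (Vec d)) (s : Vec d → Vec d) (R L : ℝ) (K : ℕ)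
    (W : ℕ → ℕ → Vec d) (t : ℕ) : Vec d :=
  (1 / (K : ℝ)) • ∑ k ∈ Finset.range K,
    s (queryPoint S s R L K W t + gammaSmooth R d t • W t k)

theorem stateVal_mem (hcv : Convex ℝ S) (hcl : IsClosed S) (h0 : (0 : Vec d) ∈ S)
    (W : ℕ → ℕ → Vec d) (t : ℕ) :
    (stateVal S s R L K W t).x ∈ S ∧ (stateVal S s R L K W t).z ∈ S := by
  induction t with
  | zero => exact ⟨h0, h0⟩
  | succ t ih =>
    have hz : (stateVal S s R L K W (t + 1)).z ∈ S := (argminOn_spec hcl ⟨0, h0⟩ _).1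
    exact ⟨hcv ih.1 hz (sub_nonneg.2 (alpha_le_one t)) (alpha_pos t).le (by ring), hz⟩

/-- By induction the two runs visit the same points, so oracles that agree only almost everywhere
can be exchanged once those points avoid the exceptional set. -/
theorem stateVal_congr {s' : Vec d → Vec d} {W : ℕ → ℕ → Vec d}
    (h : ∀ t k, s (queryPoint S s' R L K W t + gammaSmooth R d t • W t k) =
      s' (queryPoint S s' R L K W t + gammaSmooth R d t • W t k)) (t : ℕ) :
    stateVal S s R L K W t = stateVal S s' R L K W t := by
  induction t with
  | zero => rfl
  | succ t ih =>
    rw [stateVal, ih]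
    have : ∑ k ∈ Finset.range K,
        s (queryPoint S s' R L K W t + gammaSmooth R d t • W t k) =
      ∑ k ∈ Finset.range K,
        s' (queryPoint S s' R L K W t + gammaSmooth R d t • W t k) :=
      Finset.sum_congr rfl fun k _ => h t k
    simp only [queryPoint] at this
    simp only [stateVal, stepVal, this]

variable {Ω : Type*} [MeasurableSpace Ω] {W : ℕ → ℕ → Ω → Vec d}

/-- Only samples of iterations before t are required to be measurable, so the σ-algebra may be one
that excludes a sample of iteration t. This encodes that the iterate depends on the past alone. -/
theorem measurable_stateVal (hcv : Convex ℝ S) (hcl : IsClosed S) (hne : S.Nonempty)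
    (hs : Measurable s) (t : ℕ) (hW : ∀ a < t, ∀ k, Measurable (W a k)) :
    Measurable (fun ω => (stateVal S s R L K (fun t k => W t k ω) t).x) ∧
    Measurable (fun ω => (stateVal S s R L K (fun t k => W t k ω) t).z) ∧
    Measurable (fun ω => (stateVal S s R L K (fun t k => W t k ω) t).G) := by
  induction t with
  | zero => exact ⟨measurable_const, measurable_const, measurable_const⟩
  | succ t ih =>
    obtain ⟨hx, hz, hG⟩ := ih fun a ha => hW a (ha.trans t.lt_succ_self)
    have hG' : Measurable fun ω => (stateVal S s R L K (fun t k => W t k ω) (t + 1)).G := by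
      have hWt := hW t t.lt_succ_self
      simp only [stateVal, stepVal]
      fun_prop
    have hz' : Measurable fun ω => (stateVal S s R L K (fun t k => W t k ω) (t + 1)).z :=
      (continuous_argminOn hcv hcl hne).measurable.comp
        (by fun_prop : Measurable fun ω =>
          etaStep R L d K (t + 1) • (stateVal S s R L K (fun t k => W t k ω) (t + 1)).G)
    have hx' : Measurable fun ω => (1 - alpha t) • (stateVal S s R L K (fun t k => W t k ω) t).x +
        alpha t • (stateVal S s R L K (fun t k => W t k ω) (t + 1)).z := by fun_prop
    exact ⟨hx', hz', hG'⟩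

theorem measurable_queryPoint (hcv : Convex ℝ S) (hcl : IsClosed S) (hne : S.Nonempty)
    (hs : Measurable s) (t : ℕ) (hW : ∀ a < t, ∀ k, Measurable (W a k)) :
    Measurable fun ω => queryPoint S s R L K (fun t k => W t k ω) t := by
  obtain ⟨hx, hz, -⟩ := measurable_stateVal (R := R) (L := L) (K := K) hcv hcl hne hs t hW
  unfold queryPoint
  fun_prop

theorem measurable_gradEstimate (hcv : Convex ℝ S) (hcl : IsClosed S) (hne : S.Nonempty)
    (hs : Measurable s) (t : ℕ) (hW : ∀ a ≤ t, ∀ k, Measurable (W a k)) :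
    Measurable fun ω => gradEstimate S s R L K (fun t k => W t k ω) t := by
  have hy := measurable_queryPoint (R := R) (L := L) (K := K) hcv hcl hne hs t
    fun a ha => hW a (le_of_lt ha)
  have hWt := hW t le_rfl
  unfold gradEstimate
  fun_prop

end Iterates

/-! ### Sampling independently of the past -/

section Sampling

theorem map_prodMk_of_indep {Ω E F : Type*} [MeasurableSpace E] [MeasurableSpace F]
    {m mΩ : MeasurableSpace Ω} {P : Measure Ω} [IsProbabilityMeasure P] {X : Ω → E} (hm : m ≤ mΩ)
    (hX : Measurable X) (hind : Indep m (MeasurableSpace.comap X inferInstance) P)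
    {U : Ω → F} (hU : Measurable[m] U) :
    P.map (fun ω => (U ω, X ω)) = (P.map U).prod (P.map X) := by
  have h : IndepFun U X P := by
    rw [IndepFun_iff_Indep]
    exact indep_of_indep_of_le_left hind hU.comap_le
  exact (indepFun_iff_map_prod_eq_prod_map_map (hU.mono hm le_rfl).aemeasurable
    hX.aemeasurable).1 h

variable {E : Type*} [NormedAddCommGroup E] [InnerProductSpace ℝ E] [FiniteDimensional ℝ E]
  [MeasurableSpace E] [BorelSpace E] {Ω : Type*} {m mΩ : MeasurableSpace Ω} {P : Measure Ω}
  [IsProbabilityMeasure P] {X : Ω → E}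

/-- By Fubini the base point can be frozen, and a nondegenerate Gaussian perturbation of a fixed
point avoids null sets. -/
theorem ae_sample_of_ae (hm : m ≤ mΩ) (hX : Measurable X)
    (hlaw : P.map X = stdGaussian E) (hind : Indep m (MeasurableSpace.comap X inferInstance) P)
    {Y : Ω → E} (hY : Measurable[m] Y) {p : E → Prop} (hpm : MeasurableSet {θ | p θ})
    (hp : ∀ᵐ θ, p θ) {γ : ℝ} (hγ : γ ≠ 0) : ∀ᵐ ω ∂P, p (Y ω + γ • X ω) := by
  have hYm : Measurable Y := hY.mono hm le_rfl
  have : IsProbabilityMeasure (P.map Y) := Measure.isProbabilityMeasure_map hYm.aemeasurable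
  have h : ∀ᵐ q ∂P.map (fun ω => (Y ω, X ω)), p (q.1 + γ • q.2) := by
    rw [map_prodMk_of_indep hm hX hind hY, hlaw, Measure.ae_prod_iff_ae_ae]
    · exact .of_forall fun y => ae_stdGaussian_of_ae hp hγ y
    · exact (by fun_prop : Measurable fun q : E × E => q.1 + γ • q.2) hpm
  exact ae_of_ae_map (hYm.prodMk hX).aemeasurable h

/-- The sampling error of an oracle. -/
noncomputable def sampleError (s : E → E) (γ : ℝ) (y x : E) : E :=
  s (y + γ • x) - smoothGrad s γ y

variable {s : E → E} {M : ℝ}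

theorem measurable_sampleError (hs : Measurable s) (γ : ℝ) :
    Measurable fun q : E × E => sampleError s γ q.1 q.2 :=
  (hs.comp (by fun_prop : Measurable fun q : E × E => q.1 + γ • q.2)).sub
    ((measurable_smoothGrad hs γ).comp measurable_fst)

theorem norm_sampleError_le (hsb : ∀ θ, ‖s θ‖ ≤ M) (γ : ℝ) (y x : E) :
    ‖sampleError s γ y x‖ ≤ 2 * M := by
  have := norm_sub_le (s (y + γ • x)) (smoothGrad s γ y)
  have h1 := hsb (y + γ • x)
  have h2 := norm_smoothGrad_le hsb γ y
  rw [sampleError]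
  linarith

theorem abs_inner_sampleError_le (hsb : ∀ θ, ‖s θ‖ ≤ M) (γ : ℝ) {b : E} {B : ℝ} (hb : ‖b‖ ≤ B)
    (y x : E) : |inner ℝ b (sampleError s γ y x)| ≤ B * (2 * M) :=
  (abs_real_inner_le_norm _ _).trans (mul_le_mul hb (norm_sampleError_le hsb γ y x)
    (norm_nonneg _) ((norm_nonneg _).trans hb))

theorem integrable_inner_sampleError (hX : Measurable X)
    (hs : Measurable s) (hsb : ∀ θ, ‖s θ‖ ≤ M) (γ : ℝ) {b Y : Ω → E} {B : ℝ}
    (hb : Measurable b) (hbB : ∀ ω, ‖b ω‖ ≤ B) (hY : Measurable Y) :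
    Integrable (fun ω => inner ℝ (b ω) (sampleError s γ (Y ω) (X ω))) P :=
  Integrable.of_bound
    (hb.inner ((measurable_sampleError hs γ).comp (hY.prodMk hX))).aestronglyMeasurable _
    (.of_forall fun ω => abs_inner_sampleError_le hsb γ (hbB ω) (Y ω) (X ω))

/-- The sampling error is orthogonal to everything determined independently of the sample. -/
theorem integral_inner_sampleError (hm : m ≤ mΩ) (hX : Measurable X)
    (hlaw : P.map X = stdGaussian E) (hind : Indep m (MeasurableSpace.comap X inferInstance) P)
    (hs : Measurable s) (hsb : ∀ θ, ‖s θ‖ ≤ M) (γ : ℝ) {b Y : Ω → E} {B : ℝ}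
    (hb : Measurable[m] b) (hbB : ∀ ω, ‖b ω‖ ≤ B) (hY : Measurable[m] Y) :
    ∫ ω, inner ℝ (b ω) (sampleError s γ (Y ω) (X ω)) ∂P = 0 := by
  have hbm : Measurable b := hb.mono hm le_rfl
  have hYm : Measurable Y := hY.mono hm le_rfl
  have hU : Measurable[m] fun ω => (b ω, Y ω) := hb.prodMk hY
  have hUm : Measurable fun ω => (b ω, Y ω) := hU.mono hm le_rfl
  have hφ : Measurable fun q : (E × E) × E => inner ℝ q.1.1 (sampleError s γ q.1.2 q.2) :=
    (measurable_fst.comp measurable_fst).inner ((measurable_sampleError hs γ).comp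
      ((measurable_snd.comp measurable_fst).prodMk measurable_snd))
  have : IsProbabilityMeasure (P.map fun ω => (b ω, Y ω)) :=
    Measure.isProbabilityMeasure_map hUm.aemeasurable
  have e := integral_map (μ := P) (hUm.prodMk hX).aemeasurable
    (f := fun q : (E × E) × E => inner ℝ q.1.1 (sampleError s γ q.1.2 q.2))
    hφ.aestronglyMeasurable
  have hint : Integrable (fun q : (E × E) × E => inner ℝ q.1.1 (sampleError s γ q.1.2 q.2))
      (P.map fun ω => ((b ω, Y ω), X ω)) :=
    (integrable_map_measure hφ.aestronglyMeasurable (hUm.prodMk hX).aemeasurable).2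
      (integrable_inner_sampleError hX hs hsb γ hbm hbB hYm)
  rw [← e]
  rw [map_prodMk_of_indep hm hX hind hU, hlaw] at hint ⊢
  rw [integral_prod _ hint]
  -- With the past frozen, the inner integral vanishes because `smoothGrad` is the mean of the
  -- sampled oracle.
  refine integral_eq_zero_of_ae (.of_forall fun u => ?_)
  have hi := integrable_oracle (s := s) hs hsb γ u.2
  simp only [sampleError, inner_sub_right, Pi.zero_apply]
  rw [integral_sub (hi.const_inner _) (integrable_const _), integral_inner hi]
  simp [smoothGrad]

/-- A variance is at most a second moment: the cross term with the mean integrates to 0. This gives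
M² where the pointwise bound would give 4M². -/
theorem integral_norm_sq_sampleError_le (hm : m ≤ mΩ) (hX : Measurable X)
    (hlaw : P.map X = stdGaussian E) (hind : Indep m (MeasurableSpace.comap X inferInstance) P)
    (hs : Measurable s) (hsb : ∀ θ, ‖s θ‖ ≤ M) (γ : ℝ) {Y : Ω → E} (hY : Measurable[m] Y) :
    ∫ ω, ‖sampleError s γ (Y ω) (X ω)‖ ^ 2 ∂P ≤ M ^ 2 := by
  have hYm : Measurable Y := hY.mono hm le_rfl
  have hbm := (measurable_smoothGrad hs γ).comp hY
  have hbB : ∀ ω, ‖(smoothGrad s γ ∘ Y) ω‖ ≤ M := fun ω => norm_smoothGrad_le hsb γ _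
  have h0 := integral_inner_sampleError hm hX hlaw hind hs hsb γ hbm hbB hY
  have hi := integrable_inner_sampleError (P := P) hX hs hsb γ (hbm.mono hm le_rfl) hbB hYm
  have hmeas : Measurable fun ω => sampleError s γ (Y ω) (X ω) :=
    (measurable_sampleError hs γ).comp (hYm.prodMk hX)
  calc ∫ ω, ‖sampleError s γ (Y ω) (X ω)‖ ^ 2 ∂P
      ≤ ∫ ω, (M ^ 2 - 2 * inner ℝ ((smoothGrad s γ ∘ Y) ω) (sampleError s γ (Y ω) (X ω))) ∂P := by
        refine integral_mono ?_ ((integrable_const _).sub (hi.const_mul 2)) fun ω => ?_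
        · refine Integrable.of_bound (hmeas.norm.pow_const 2).aestronglyMeasurable ((2 * M) ^ 2)
            (.of_forall fun ω => ?_)
          rw [Real.norm_eq_abs, abs_of_nonneg (by positivity)]
          gcongr
          exact norm_sampleError_le hsb γ _ _
        · have h1 : ‖s (Y ω + γ • X ω)‖ ^ 2 ≤ M ^ 2 := by
            gcongr
            exact hsb _
          have h2 : s (Y ω + γ • X ω) = smoothGrad s γ (Y ω) + sampleError s γ (Y ω) (X ω) := by
            rw [sampleError]; abel
          rw [h2, norm_add_sq_real] at h1
          have := sq_nonneg ‖smoothGrad s γ (Y ω)‖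
          simp only [Function.comp_apply]
          linarith
    _ = M ^ 2 := by
        rw [integral_sub (integrable_const _) (hi.const_mul 2), integral_const_mul, h0]
        simp

end Sampling

/-! ### Averages over a family of independent samples -/

section Family

section OtherSamples

variable {E Ω ι : Type*} [MeasurableSpace E]

/-- The information carried by all samples except the `i`-th. -/
@[reducible]
def otherSamples (W : ι → Ω → E) (i : ι) : MeasurableSpace Ω :=
  ⨆ p ∈ ({i}ᶜ : Set ι), MeasurableSpace.comap (W p) inferInstance

theorem measurable_otherSamples {W : ι → Ω → E} {i p : ι} (h : p ≠ i) :
    Measurable[otherSamples W i] (W p) := by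
  have hle : MeasurableSpace.comap (W p) inferInstance ≤ otherSamples W i :=
    le_iSup₂ (f := fun p (_ : p ∈ ({i}ᶜ : Set ι)) => MeasurableSpace.comap (W p) inferInstance) p h
  exact (comap_measurable (W p)).mono hle le_rfl

theorem otherSamples_le [mΩ : MeasurableSpace Ω] {W : ι → Ω → E} (hW : ∀ p, Measurable (W p))
    (i : ι) : otherSamples W i ≤ mΩ :=
  iSup₂_le fun p _ => (hW p).comap_le

/-- Besides the past, this σ-algebra contains the other samples of the same iteration; it therefore
yields both unbiasedness and the vanishing of cross terms. -/
theorem indep_otherSamples [MeasurableSpace Ω] {P : Measure Ω} {W : ι → Ω → E}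
    (hW : ∀ p, Measurable (W p))
    (hind : iIndepFun W P) (i : ι) :
    Indep (otherSamples W i) (MeasurableSpace.comap (W i) inferInstance) P := by
  have h := indep_iSup_of_disjoint (fun p => (hW p).comap_le) hind.iIndep
    (disjoint_compl_left (a := ({i} : Set ι)))
  simpa [otherSamples] using h

end OtherSamples

variable {E : Type*} [NormedAddCommGroup E] [InnerProductSpace ℝ E] [FiniteDimensional ℝ E]
  [MeasurableSpace E] [BorelSpace E] {Ω ι : Type*} [MeasurableSpace Ω]

/-- The squared error of an average of `K` samples is at most `M² / K`. -/
theorem integral_norm_sq_avg_sampleError_le {P : Measure Ω} [IsProbabilityMeasure P]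
    {W : ι → Ω → E} (hW : ∀ p, Measurable (W p)) (hlaw : ∀ p, P.map (W p) = stdGaussian E)
    (hind : iIndepFun W P) {s : E → E} {M : ℝ} (hs : Measurable s) (hsb : ∀ θ, ‖s θ‖ ≤ M) (γ : ℝ)
    {K : ℕ} (hK : 0 < K) {j : ℕ → ι} (hj : Function.Injective j) {Y : Ω → E}
    (hY : ∀ k, Measurable[otherSamples W (j k)] Y) :
    ∫ ω, ‖(1 / (K : ℝ)) • ∑ k ∈ Finset.range K, sampleError s γ (Y ω) (W (j k) ω)‖ ^ 2 ∂P ≤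
      M ^ 2 / K := by
  have hYm : Measurable Y := (hY 0).mono (otherSamples_le hW _) le_rfl
  have hξm : ∀ k, Measurable fun ω => sampleError s γ (Y ω) (W (j k) ω) := fun k =>
    (measurable_sampleError hs γ).comp (hYm.prodMk (hW _))
  have e : ∀ ω, ‖(1 / (K : ℝ)) • ∑ k ∈ Finset.range K, sampleError s γ (Y ω) (W (j k) ω)‖ ^ 2 =
      (1 / (K : ℝ)) ^ 2 * ∑ l ∈ Finset.range K, ∑ k ∈ Finset.range K,
        inner ℝ (sampleError s γ (Y ω) (W (j l) ω)) (sampleError s γ (Y ω) (W (j k) ω)) := by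
    intro ω
    rw [norm_smul, mul_pow, Real.norm_eq_abs, sq_abs, ← real_inner_self_eq_norm_sq, sum_inner]
    simp_rw [inner_sum]
  have hint : ∀ l k, Integrable (fun ω =>
      inner ℝ (sampleError s γ (Y ω) (W (j l) ω)) (sampleError s γ (Y ω) (W (j k) ω))) P :=
    fun l k => integrable_inner_sampleError (hW _) hs hsb γ (hξm l)
      (fun ω => norm_sampleError_le hsb γ _ _) hYm
  -- Off the diagonal, the l-th error is a function of samples other than the k-th, hence orthogonal
  -- to the k-th error.
  have hle : ∀ l k, ∫ ω, inner ℝ (sampleError s γ (Y ω) (W (j l) ω))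
      (sampleError s γ (Y ω) (W (j k) ω)) ∂P ≤ if l = k then M ^ 2 else 0 := by
    intro l k
    split_ifs with h
    · subst h
      simp_rw [real_inner_self_eq_norm_sq]
      exact integral_norm_sq_sampleError_le (otherSamples_le hW _) (hW _) (hlaw _)
        (indep_otherSamples hW hind _) hs hsb γ (hY l)
    · refine (integral_inner_sampleError (otherSamples_le hW _) (hW _) (hlaw _)
        (indep_otherSamples hW hind _) hs hsb γ ?_
        (fun ω => norm_sampleError_le hsb γ _ _) (hY k)).le
      exact (measurable_sampleError hs γ).comp
        ((hY k).prodMk (measurable_otherSamples (hj.ne h)))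
  simp_rw [e]
  rw [integral_const_mul,
    integral_finsetSum _ fun l _ => integrable_finsetSum _ fun k _ => hint l k]
  simp_rw [integral_finsetSum _ fun k _ => hint _ k]
  calc _ ≤ (1 / (K : ℝ)) ^ 2 * ∑ l ∈ Finset.range K, ∑ k ∈ Finset.range K,
        (if l = k then M ^ 2 else 0) := by
        gcongr
        exact hle _ _
    _ = (1 / (K : ℝ)) ^ 2 * ∑ l ∈ Finset.range K, M ^ 2 := by
        congr 1
        refine Finset.sum_congr rfl fun l hl => ?_
        rw [Finset.sum_ite_eq, if_pos hl]
    _ = M ^ 2 / K := by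
        rw [Finset.sum_const, Finset.card_range, nsmul_eq_mul]
        field_simp

end Family

/-! ### Convergence of randomized smoothing -/

section Convergence

theorem measurable_otherSamples_of_lt {E Ω : Type*} [MeasurableSpace E]
    {W : ℕ → ℕ → Ω → E} {t a : ℕ}
    (ha : a < t) (k l : ℕ) :
    Measurable[otherSamples (fun p : ℕ × ℕ => W p.1 p.2) (t, l)] (W a k) :=
  measurable_otherSamples (W := fun p : ℕ × ℕ => W p.1 p.2) (p := (a, k)) (i := (t, l))
    fun h => ha.ne (congrArg Prod.fst h)

variable {d : ℕ} {S : Set (Vec d)} {f : Vec d → ℝ} {s : Vec d → Vec d} {R L : ℝ} {K : ℕ}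

theorem gammaSmooth_pos (hR : 0 < R) (hd : 0 < d) (t : ℕ) : 0 < gammaSmooth R d t := by
  have := alpha_pos t
  unfold gammaSmooth
  positivity

theorem etaStep_pos (hR : 0 < R) (hL : 0 < L) (hd : 0 < d) (t : ℕ) : 0 < etaStep R L d K t := by
  have := alpha_pos t
  unfold etaStep
  positivity

theorem inv_etaStep (t : ℕ) : (etaStep R L d K t)⁻¹ =
    2 * L * ((d : ℝ) ^ (1 / 4 : ℝ) + √(((t : ℝ) + 1) / K)) / R * (alpha t)⁻¹ := by
  rw [etaStep, inv_div]
  ring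

theorem inv_etaStep_le_succ (hR : 0 < R) (hL : 0 < L) (t : ℕ) :
    (etaStep R L d K t)⁻¹ ≤ (etaStep R L d K (t + 1))⁻¹ := by
  rw [inv_etaStep, inv_etaStep]
  have h1 := alpha_succ_le t
  have h2 := alpha_pos (t + 1)
  have h3 := (inv_pos.2 (alpha_pos t)).le
  push_cast
  gcongr; linarith

/-- The weight given to the gradient error of iteration `t`. -/
noncomputable def errorWeight (R L : ℝ) (K t : ℕ) : ℝ :=
  2 * L * √(((t : ℝ) + 1) / K) / R * (alpha t)⁻¹

theorem errorWeight_pos (hR : 0 < R) (hL : 0 < L) (hK : 0 < K) (t : ℕ) :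
    0 < errorWeight R L K t := by
  have := alpha_pos t
  unfold errorWeight
  positivity

theorem div_gammaSmooth (t : ℕ) : L / gammaSmooth R d t =
    L * (d : ℝ) ^ (1 / 4 : ℝ) / R * (alpha t)⁻¹ := by
  rw [gammaSmooth, Real.rpow_neg d.cast_nonneg]
  simp only [div_eq_mul_inv, mul_inv, inv_inv]
  ring

/-- The exponent -1/4 balances the bias Lγ√d against the curvature L/γ: both become proportional to
d^{1/4}. -/
theorem gammaSmooth_mul_sqrt (hd : 0 < d) (t : ℕ) :
    gammaSmooth R d t * √d = R * (d : ℝ) ^ (1 / 4 : ℝ) * alpha t := by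
  have hd' : (0 : ℝ) < d := Nat.cast_pos.2 hd
  have e : (d : ℝ) ^ (-(1 / 4) : ℝ) * √d = (d : ℝ) ^ (1 / 4 : ℝ) := by
    rw [Real.sqrt_eq_rpow, ← Real.rpow_add hd']
    norm_num
  rw [gammaSmooth, ← e]
  ring

theorem stateVal_gap_le (hcv : Convex ℝ S) (hcl : IsClosed S) (h0 : (0 : Vec d) ∈ S)
    (hR : 0 < R) (hL : 0 < L) (hd : 0 < d) (hK : 0 < K)
    (hfc : ConvexOn ℝ Set.univ f) (hf : ∀ x y, |f x - f y| ≤ L * ‖x - y‖)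
    (hsm : Measurable s) (hsb : ∀ θ, ‖s θ‖ ≤ L)
    (hs : ∀ᵐ θ, ∀ x, f θ + inner ℝ (s θ) (x - θ) ≤ f x) (W : ℕ → ℕ → Vec d) {θ : Vec d}
    (hθ : θ ∈ S) (T : ℕ) :
    (∑ t ∈ Finset.range T, (alpha t)⁻¹) *
        smooth f (gammaSmooth R d (T - 1)) (stateVal S s R L K W T).x ≤
      ∑ t ∈ Finset.range T, ((alpha t)⁻¹ * (smooth f (gammaSmooth R d t) θ +
        inner ℝ (gradEstimate S s R L K W t -
          smoothGrad s (gammaSmooth R d t) (queryPoint S s R L K W t))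
            (θ - (stateVal S s R L K W t).z)) +
        (alpha t)⁻¹ ^ 2 * ‖gradEstimate S s R L K W t -
          smoothGrad s (gammaSmooth R d t) (queryPoint S s R L K W t)‖ ^ 2 /
            (2 * errorWeight R L K t)) + (etaStep R L d K T)⁻¹ / 2 * ‖θ‖ ^ 2 := by
  refine accelerated_dual_averaging_le (S := S) (x := fun t => (stateVal S s R L K W t).x)
    (z := fun t => (stateVal S s R L K W t).z) (G := fun t => (stateVal S s R L K W t).G)
    (y := queryPoint S s R L K W) (gh := gradEstimate S s R L K W)
    (m := fun t => smoothGrad s (gammaSmooth R d t) (queryPoint S s R L K W t))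
    (F := fun t => smooth f (gammaSmooth R d t)) (β := fun t => (etaStep R L d K t)⁻¹)
    (Λ := fun t => L / gammaSmooth R d t) (c := errorWeight R L K)
    rfl rfl (fun t => rfl) (fun t => ?_) (fun t => rfl)
    (fun t => (stateVal_mem hcv hcl h0 W t).2) (fun t u hu => ?_)
    (fun t => (inv_pos.2 (etaStep_pos hR hL hd t)).le) (inv_etaStep_le_succ hR hL)
    (fun t => ?_) (fun t u => ?_) (fun t u => ?_) (errorWeight_pos hR hL hK) (fun t => ?_) hθ T
  · rw [← one_div]
    rfl
  -- The initial z is not produced by `argminOn`; with z = G = 0 the inequality is immediate.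
  · cases t with
    | zero => simp [stateVal]
    | succ t => exact argminOn_dual_averaging hcv hcl ⟨0, h0⟩ (etaStep_pos hR hL hd _) _ hu
  · have h := smooth_add_le hf hsm hsb hs (gammaSmooth_pos hR hd t) (queryPoint S s R L K W t)
      ((stateVal S s R L K W (t + 1)).x - queryPoint S s R L K W t)
    rwa [add_sub_cancel] at h
  · exact smooth_add_inner_le hf hsm hsb hs (gammaSmooth_pos hR hd t).ne' _ _
  · refine smooth_mono hfc hf (gammaSmooth_pos hR hd _).le ?_ u
    unfold gammaSmooth
    have := alpha_succ_le t
    gcongr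
  -- The two summands in the denominator of η_t are made for this: one matches the curvature, the
  -- other the noise, and equality holds.
  · rw [div_gammaSmooth, inv_etaStep, errorWeight]
    apply le_of_eq
    ring

variable {Ω : Type*} [MeasurableSpace Ω] {P : Measure Ω} [IsProbabilityMeasure P]
  {W : ℕ → ℕ → Ω → Vec d}

theorem gradEstimate_sub (hK : 0 < K) (w : ℕ → ℕ → Vec d) (t : ℕ) :
    gradEstimate S s R L K w t - smoothGrad s (gammaSmooth R d t) (queryPoint S s R L K w t) =
      (1 / (K : ℝ)) • ∑ k ∈ Finset.range K,
        sampleError s (gammaSmooth R d t) (queryPoint S s R L K w t) (w t k) := by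
  have hK' : (K : ℝ) ≠ 0 := by positivity
  simp only [sampleError, Finset.sum_sub_distrib, Finset.sum_const, Finset.card_range,
    ← Nat.cast_smul_eq_nsmul ℝ, smul_sub, smul_smul, one_div, inv_mul_cancel₀ hK', one_smul,
    gradEstimate]

theorem norm_gradEstimate_sub_le (hsb : ∀ θ, ‖s θ‖ ≤ L) (hK : 0 < K) (w : ℕ → ℕ → Vec d) (t : ℕ) :
    ‖gradEstimate S s R L K w t -
      smoothGrad s (gammaSmooth R d t) (queryPoint S s R L K w t)‖ ≤ 2 * L := by
  have hK' : (0 : ℝ) < K := by positivity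
  rw [gradEstimate_sub hK, norm_smul, Real.norm_eq_abs, abs_of_pos (by positivity)]
  calc _ ≤ 1 / (K : ℝ) * ∑ k ∈ Finset.range K, 2 * L := by
        gcongr
        exact norm_sum_le_of_le _ fun k _ => norm_sampleError_le hsb _ _ _
    _ = 2 * L := by
        rw [Finset.sum_const, Finset.card_range, nsmul_eq_mul]
        field_simp

theorem integrable_comp_stateVal (hcv : Convex ℝ S) (hcl : IsClosed S) (h0 : (0 : Vec d) ∈ S)
    (hSR : ∀ θ ∈ S, ‖θ‖ ≤ R) (hL : 0 ≤ L) (hf : ∀ x y, |f x - f y| ≤ L * ‖x - y‖)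
    (hsm : Measurable s) (hW : ∀ t k, Measurable (W t k)) (T : ℕ) :
    Integrable (fun ω => f (stateVal S s R L K (fun t k => W t k ω) T).x) P := by
  have hx := (measurable_stateVal (R := R) (L := L) (K := K) hcv hcl ⟨0, h0⟩ hsm T
    fun a _ => hW a).1
  refine Integrable.of_bound ((continuous_of_abs_sub_le hf).measurable.comp hx).aestronglyMeasurable
    (|f 0| + L * R) (.of_forall fun ω => ?_)
  have h1 := hf (stateVal S s R L K (fun t k => W t k ω) T).x 0
  rw [sub_zero] at h1
  have h2 := mul_le_mul_of_nonneg_left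
    (hSR _ (stateVal_mem (s := s) (R := R) (L := L) (K := K) hcv hcl h0
      (fun t k => W t k ω) T).1) hL
  have h3 := abs_sub_abs_le_abs_sub (f (stateVal S s R L K (fun t k => W t k ω) T).x) (f 0)
  rw [Real.norm_eq_abs]
  linarith

/-- The gradient error of an iteration is uncorrelated with the current iterate. -/
theorem integral_inner_gradEstimate_sub (hcv : Convex ℝ S) (hcl : IsClosed S)
    (h0 : (0 : Vec d) ∈ S) (hSR : ∀ θ ∈ S, ‖θ‖ ≤ R) (hK : 0 < K) (hsm : Measurable s)
    (hsb : ∀ θ, ‖s θ‖ ≤ L) (hW : ∀ t k, Measurable (W t k))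
    (hlaw : ∀ t k, P.map (W t k) = stdGaussian (Vec d))
    (hind : iIndepFun (fun p : ℕ × ℕ => W p.1 p.2) P) {θ : Vec d} (hθ : θ ∈ S) (t : ℕ) :
    Integrable (fun ω => inner ℝ (gradEstimate S s R L K (fun t k => W t k ω) t -
      smoothGrad s (gammaSmooth R d t) (queryPoint S s R L K (fun t k => W t k ω) t))
        (θ - (stateVal S s R L K (fun t k => W t k ω) t).z)) P ∧
    ∫ ω, inner ℝ (gradEstimate S s R L K (fun t k => W t k ω) t -
      smoothGrad s (gammaSmooth R d t) (queryPoint S s R L K (fun t k => W t k ω) t))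
        (θ - (stateVal S s R L K (fun t k => W t k ω) t).z) ∂P = 0 := by
  have e : ∀ ω, inner ℝ (gradEstimate S s R L K (fun t k => W t k ω) t -
      smoothGrad s (gammaSmooth R d t) (queryPoint S s R L K (fun t k => W t k ω) t))
        (θ - (stateVal S s R L K (fun t k => W t k ω) t).z) =
      (1 / (K : ℝ)) * ∑ k ∈ Finset.range K,
        inner ℝ (θ - (stateVal S s R L K (fun t k => W t k ω) t).z)
          (sampleError s (gammaSmooth R d t) (queryPoint S s R L K (fun t k => W t k ω) t)
            (W t k ω)) := by
    intro ω
    rw [gradEstimate_sub hK, real_inner_smul_left, real_inner_comm, inner_sum]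
  have hWm : ∀ p : ℕ × ℕ, Measurable (W p.1 p.2) := fun p => hW _ _
  have hB : ∀ ω, ‖θ - (stateVal S s R L K (fun t k => W t k ω) t).z‖ ≤ R + R := fun ω =>
    (norm_sub_le _ _).trans (add_le_add (hSR _ hθ)
      (hSR _ (stateVal_mem hcv hcl h0 (fun t k => W t k ω) t).2))
  -- The σ-algebra on Ω is replaced by the one omitting sample (t, k), on which z_t does not depend.
  have hb : ∀ k, Measurable[otherSamples (fun p : ℕ × ℕ => W p.1 p.2) (t, k)]
      fun ω => θ - (stateVal S s R L K (fun t k => W t k ω) t).z := fun k =>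
    (@measurable_stateVal d S s R L K Ω (otherSamples (fun p : ℕ × ℕ => W p.1 p.2) (t, k)) W
      hcv hcl ⟨0, h0⟩ hsm t fun a ha l => measurable_otherSamples_of_lt ha l k).2.1.const_sub θ
  have hy : ∀ k, Measurable[otherSamples (fun p : ℕ × ℕ => W p.1 p.2) (t, k)]
      fun ω => queryPoint S s R L K (fun t k => W t k ω) t := fun k =>
    @measurable_queryPoint d S s R L K Ω (otherSamples (fun p : ℕ × ℕ => W p.1 p.2) (t, k)) W
      hcv hcl ⟨0, h0⟩ hsm t fun a ha l => measurable_otherSamples_of_lt ha l k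
  have hle := fun k => otherSamples_le hWm (t, k)
  have hint := fun k => integrable_inner_sampleError (P := P) (hW t k) hsm hsb (gammaSmooth R d t)
    ((hb k).mono (hle k) le_rfl) hB ((hy k).mono (hle k) le_rfl)
  simp_rw [e]
  refine ⟨(integrable_finsetSum _ fun k _ => hint k).const_mul _, ?_⟩
  rw [integral_const_mul, integral_finsetSum _ fun k _ => hint k, Finset.sum_eq_zero, mul_zero]
  intro k _
  exact integral_inner_sampleError (hle k) (hW t k) (hlaw t k)
    (indep_otherSamples hWm hind (t, k)) hsm hsb _ (hb k) hB (hy k)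

theorem integral_norm_sq_gradEstimate_sub_le (hcv : Convex ℝ S) (hcl : IsClosed S)
    (h0 : (0 : Vec d) ∈ S) (hK : 0 < K) (hsm : Measurable s)
    (hsb : ∀ θ, ‖s θ‖ ≤ L) (hW : ∀ t k, Measurable (W t k))
    (hlaw : ∀ t k, P.map (W t k) = stdGaussian (Vec d))
    (hind : iIndepFun (fun p : ℕ × ℕ => W p.1 p.2) P) (t : ℕ) :
    Integrable (fun ω => ‖gradEstimate S s R L K (fun t k => W t k ω) t -
      smoothGrad s (gammaSmooth R d t) (queryPoint S s R L K (fun t k => W t k ω) t)‖ ^ 2) P ∧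
    ∫ ω, ‖gradEstimate S s R L K (fun t k => W t k ω) t -
      smoothGrad s (gammaSmooth R d t) (queryPoint S s R L K (fun t k => W t k ω) t)‖ ^ 2 ∂P ≤
        L ^ 2 / K := by
  constructor
  · have hg := measurable_gradEstimate (R := R) (L := L) (K := K) hcv hcl ⟨0, h0⟩ hsm t
      fun a _ => hW a
    have hy := measurable_queryPoint (R := R) (L := L) (K := K) hcv hcl ⟨0, h0⟩ hsm t
      fun a _ => hW a
    refine Integrable.of_bound ((hg.sub ((measurable_smoothGrad hsm _).comp hy)).norm.pow_const
      2).aestronglyMeasurable ((2 * L) ^ 2) (.of_forall fun ω => ?_)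
    rw [Real.norm_eq_abs, abs_of_nonneg (by positivity)]
    gcongr
    exact norm_gradEstimate_sub_le hsb hK _ t
  · simp_rw [gradEstimate_sub hK]
    exact integral_norm_sq_avg_sampleError_le (W := fun p : ℕ × ℕ => W p.1 p.2)
      (fun p => hW _ _) (fun p => hlaw _ _) hind hsm hsb (gammaSmooth R d t) hK
      (j := fun k => (t, k)) (fun a b h => congrArg Prod.snd h)
      (fun k => @measurable_queryPoint d S s R L K Ω
        (otherSamples (fun p : ℕ × ℕ => W p.1 p.2) (t, k)) W
        hcv hcl ⟨0, h0⟩ hsm t fun a ha l => measurable_otherSamples_of_lt ha l k)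

/-- As `errorWeight` is proportional to √((t + 1)/K)/α_t, one factor 1/α_t ≤ t + 1 survives, and (t
+ 1)/K divided by its square root is the root itself. -/
theorem error_term_le (hR : 0 < R) (hL : 0 < L) (hK : 0 < K) {t n : ℕ} (ht : t ≤ n) :
    (alpha t)⁻¹ ^ 2 * (L ^ 2 / K) / (2 * errorWeight R L K t) ≤
      L * R / 4 * √(((n : ℝ) + 1) / K) := by
  have hp := inv_pos.2 (alpha_pos t)
  have hp1 := inv_alpha_le t
  set p := (alpha t)⁻¹
  have hK' : (0 : ℝ) < K := by positivity
  have hq : 0 < √(((t : ℝ) + 1) / K) := by positivity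
  have hsq := Real.sq_sqrt (by positivity : 0 ≤ ((t : ℝ) + 1) / K)
  have e : p ^ 2 * (L ^ 2 / K) / (2 * errorWeight R L K t) =
      L * R / 4 * (p / K / √(((t : ℝ) + 1) / K)) := by
    rw [errorWeight, show (alpha t)⁻¹ = p from rfl]
    field_simp
    ring
  rw [e]
  gcongr
  calc p / K / √(((t : ℝ) + 1) / K) ≤ ((t : ℝ) + 1) / K / √(((t : ℝ) + 1) / K) := by gcongr
    _ = √(((t : ℝ) + 1) / K) := by
        rw [div_eq_iff hq.ne', ← sq, hsq]
    _ ≤ √(((n : ℝ) + 1) / K) := by gcongr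

/-- Expectation of the pathwise bound, with n + 1 iterations: the linear noise disappears, the
quadratic noise is at most L²/K, and smoothing is removed by f ≤ F_γ on the left and by the bias
bound at θ. -/
theorem integral_gap_le (hcv : Convex ℝ S) (hcl : IsClosed S) (h0 : (0 : Vec d) ∈ S)
    (hSR : ∀ θ ∈ S, ‖θ‖ ≤ R) (hR : 0 < R) (hL : 0 < L) (hd : 0 < d) (hK : 0 < K)
    (hfc : ConvexOn ℝ Set.univ f) (hf : ∀ x y, |f x - f y| ≤ L * ‖x - y‖)
    (hsm : Measurable s) (hsb : ∀ θ, ‖s θ‖ ≤ L)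
    (hs : ∀ᵐ θ, ∀ x, f θ + inner ℝ (s θ) (x - θ) ≤ f x) (hW : ∀ t k, Measurable (W t k))
    (hlaw : ∀ t k, P.map (W t k) = stdGaussian (Vec d))
    (hind : iIndepFun (fun p : ℕ × ℕ => W p.1 p.2) P) {θ : Vec d} (hθ : θ ∈ S) (n : ℕ) :
    (alpha n)⁻¹ ^ 2 *
        (∫ ω, f (stateVal S s R L K (fun t k => W t k ω) (n + 1)).x ∂P - f θ) ≤
      ((n : ℝ) + 1) * (L * R * (d : ℝ) ^ (1 / 4 : ℝ) + L * R / 4 * √(((n : ℝ) + 1) / K)) +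
        L * R * ((d : ℝ) ^ (1 / 4 : ℝ) + √(((n : ℝ) + 2) / K)) * ((n : ℝ) + 2) := by
  set Q := (alpha n)⁻¹ ^ 2 with hQ
  have hQsum : ∑ t ∈ Finset.range (n + 1), (alpha t)⁻¹ = Q := sum_inv_alpha n
  have hif := integrable_comp_stateVal (P := P) (K := K) hcv hcl h0 hSR hL.le hf hsm hW (n + 1)
  let e1 : ℕ → Ω → ℝ := fun t ω => inner ℝ (gradEstimate S s R L K (fun t k => W t k ω) t -
      smoothGrad s (gammaSmooth R d t) (queryPoint S s R L K (fun t k => W t k ω) t))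
        (θ - (stateVal S s R L K (fun t k => W t k ω) t).z)
  let e2 : ℕ → Ω → ℝ := fun t ω => ‖gradEstimate S s R L K (fun t k => W t k ω) t -
      smoothGrad s (gammaSmooth R d t) (queryPoint S s R L K (fun t k => W t k ω) t)‖ ^ 2
  have hi1 : ∀ t, Integrable (e1 t) P ∧ ∫ ω, e1 t ω ∂P = 0 := fun t =>
    integral_inner_gradEstimate_sub hcv hcl h0 hSR hK hsm hsb hW hlaw hind hθ t
  have hi2 : ∀ t, Integrable (e2 t) P ∧ ∫ ω, e2 t ω ∂P ≤ L ^ 2 / K := fun t =>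
    integral_norm_sq_gradEstimate_sub_le hcv hcl h0 hK hsm hsb hW hlaw hind t
  have hia : ∀ t, Integrable
      (fun ω => (alpha t)⁻¹ * (smooth f (gammaSmooth R d t) θ + e1 t ω)) P := fun t =>
    ((integrable_const _).add (hi1 t).1).const_mul _
  have hib : ∀ t, Integrable
      (fun ω => (alpha t)⁻¹ ^ 2 * e2 t ω / (2 * errorWeight R L K t)) P := fun t =>
    ((hi2 t).1.const_mul _).div_const _
  have hint : ∀ t, Integrable (fun ω => (alpha t)⁻¹ * (smooth f (gammaSmooth R d t) θ + e1 t ω) +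
      (alpha t)⁻¹ ^ 2 * e2 t ω / (2 * errorWeight R L K t)) P := fun t =>
    (hia t).add (hib t)
  have hpath : Q * ∫ ω, f (stateVal S s R L K (fun t k => W t k ω) (n + 1)).x ∂P ≤
      ∫ ω, (∑ t ∈ Finset.range (n + 1),
        ((alpha t)⁻¹ * (smooth f (gammaSmooth R d t) θ + e1 t ω) +
          (alpha t)⁻¹ ^ 2 * e2 t ω / (2 * errorWeight R L K t)) +
        (etaStep R L d K (n + 1))⁻¹ / 2 * ‖θ‖ ^ 2) ∂P := by
    rw [← integral_const_mul]
    refine integral_mono (hif.const_mul Q)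
      ((integrable_finsetSum _ fun t _ => hint t).add (integrable_const _)) fun ω => ?_
    refine le_trans ?_ (stateVal_gap_le hcv hcl h0 hR hL hd hK hfc hf hsm hsb hs
      (fun t k => W t k ω) hθ (n + 1))
    rw [hQsum]
    exact mul_le_mul_of_nonneg_left (le_smooth hfc hf _ _) (sq_nonneg _)
  have hterm : ∀ t ∈ Finset.range (n + 1),
      ∫ ω, ((alpha t)⁻¹ * (smooth f (gammaSmooth R d t) θ + e1 t ω) +
        (alpha t)⁻¹ ^ 2 * e2 t ω / (2 * errorWeight R L K t)) ∂P ≤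
      (alpha t)⁻¹ * f θ +
        (L * R * (d : ℝ) ^ (1 / 4 : ℝ) + L * R / 4 * √(((n : ℝ) + 1) / K)) := by
    intro t ht
    have hp := inv_pos.2 (alpha_pos t)
    have hw := errorWeight_pos hR hL hK t
    rw [integral_add (hia t) (hib t), integral_div, integral_const_mul, integral_const_mul,
      integral_add (integrable_const _) (hi1 t).1, (hi1 t).2, integral_const, probReal_univ,
      one_smul, add_zero, ← add_assoc]
    have h1 := smooth_le hf hL.le (gammaSmooth_pos hR hd t).le θ
    rw [finrank_euclideanSpace_fin, mul_assoc, gammaSmooth_mul_sqrt hd] at h1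
    have h2 := mul_le_mul_of_nonneg_left h1 hp.le
    -- As γ_t is proportional to α_t, the weighted bias is the same in every iteration.
    have e : (alpha t)⁻¹ * (f θ + L * (R * (d : ℝ) ^ (1 / 4 : ℝ) * alpha t)) =
        (alpha t)⁻¹ * f θ + L * R * (d : ℝ) ^ (1 / 4 : ℝ) := by
      have := (alpha_pos t).ne'
      field_simp
    rw [e] at h2
    refine add_le_add h2 (le_trans ?_
      (error_term_le hR hL hK (Nat.lt_succ_iff.1 (Finset.mem_range.1 ht))))
    gcongr
    exact (hi2 t).2
  have hlast : (etaStep R L d K (n + 1))⁻¹ / 2 * ‖θ‖ ^ 2 ≤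
      L * R * ((d : ℝ) ^ (1 / 4 : ℝ) + √(((n : ℝ) + 2) / K)) * ((n : ℝ) + 2) := by
    have h1 := inv_alpha_le (n + 1)
    have h2 := hSR θ hθ
    have h3 := inv_pos.2 (alpha_pos (n + 1))
    rw [inv_etaStep]
    push_cast at h1 ⊢
    rw [show (n : ℝ) + 1 + 1 = n + 2 by ring] at h1 ⊢
    calc _ ≤ 2 * L * ((d : ℝ) ^ (1 / 4 : ℝ) + √(((n : ℝ) + 2) / K)) / R * ((n : ℝ) + 2) / 2 *
          R ^ 2 := by gcongr
      _ = _ := by field_simp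
  rw [integral_add (integrable_finsetSum _ fun t _ => hint t) (integrable_const _),
    integral_finsetSum _ fun t _ => hint t, integral_const, probReal_univ, one_smul] at hpath
  have hsum := Finset.sum_le_sum hterm
  rw [Finset.sum_add_distrib, ← Finset.sum_mul, hQsum, Finset.sum_const, Finset.card_range,
    nsmul_eq_mul] at hsum
  push_cast at hsum
  rw [mul_sub]
  linarith

end Convergence

/-! ### Choice of the number of iterations and of samples -/

section Parameters

variable {d : ℕ} {R L ε : ℝ}

theorem numIter_pos (hR : 0 < R) (hL : 0 < L) (hε : 0 < ε) (hd : 0 < d) :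
    0 < numIter R L ε d :=
  Nat.ceil_pos.2 (by positivity)

theorem numSamples_pos (hR : 0 < R) (hL : 0 < L) (hε : 0 < ε) (hd : 0 < d) :
    0 < numSamples R L ε d :=
  Nat.ceil_pos.2 (by positivity)

theorem ceil_nat_mul_le (m : ℕ) (x : ℝ) : ⌈m * x⌉₊ ≤ m * ⌈x⌉₊ :=
  Nat.ceil_le.2 (by push_cast; gcongr; exact Nat.le_ceil x)

theorem numIter_le : numIter R L ε d ≤ 20 * ⌈R * L * (d : ℝ) ^ (1 / 4 : ℝ) / ε⌉₊ := by
  have h := ceil_nat_mul_le 20 (R * L * (d : ℝ) ^ (1 / 4 : ℝ) / ε)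
  rw [numIter]
  convert h using 2
  push_cast
  ring

theorem numSamples_le :
    numSamples R L ε d ≤ 5 * ⌈R * L * (d : ℝ) ^ (-(1 / 4) : ℝ) / ε⌉₊ := by
  have h := ceil_nat_mul_le 5 (R * L * (d : ℝ) ^ (-(1 / 4) : ℝ) / ε)
  rw [numSamples]
  convert h using 2
  push_cast
  ring

/-- With the prescribed parameters the error bound of the method is at most `ε`. -/
theorem error_bound_le (hR : 0 < R) (hL : 0 < L) (hε : 0 < ε) (hd : 0 < d) {n : ℕ}
    (hn : numIter R L ε d = n + 1) :
    ((n : ℝ) + 1) * (L * R * (d : ℝ) ^ (1 / 4 : ℝ) +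
        L * R / 4 * √(((n : ℝ) + 1) / numSamples R L ε d)) +
      L * R * ((d : ℝ) ^ (1 / 4 : ℝ) + √(((n : ℝ) + 2) / numSamples R L ε d)) * ((n : ℝ) + 2) ≤
      ((n : ℝ) + 2) ^ 2 / 4 * ε := by
  have hKpos : (0 : ℝ) < numSamples R L ε d := Nat.cast_pos.2 (numSamples_pos hR hL hε hd)
  have hT : 20 * R * L * (d : ℝ) ^ (1 / 4 : ℝ) / ε ≤ (n : ℝ) + 1 := by
    have := Nat.le_ceil (20 * R * L * (d : ℝ) ^ (1 / 4 : ℝ) / ε)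
    rw [← numIter, hn] at this
    exact_mod_cast this
  have hK : 5 * R * L * (d : ℝ) ^ (-(1 / 4) : ℝ) / ε ≤ numSamples R L ε d := Nat.le_ceil _
  set K : ℝ := (numSamples R L ε d : ℝ)
  have hD : 0 < (d : ℝ) ^ (1 / 4 : ℝ) := by positivity
  rw [Real.rpow_neg d.cast_nonneg] at hK
  set D := (d : ℝ) ^ (1 / 4 : ℝ)
  -- The powers d^{1/4} and d^{-1/4} cancel, so the noise term is free of the dimension.
  have hTK : 100 * (R * L) ^ 2 / ε ^ 2 ≤ ((n : ℝ) + 2) * K := by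
    calc 100 * (R * L) ^ 2 / ε ^ 2 = (20 * R * L * D / ε) * (5 * R * L * D⁻¹ / ε) := by
          field_simp
          norm_num
      _ ≤ ((n : ℝ) + 2) * K := by
          gcongr
          linarith
  have hD' : L * R * D ≤ ε * ((n : ℝ) + 2) / 20 := by
    rw [div_le_iff₀ hε] at hT
    nlinarith
  have hsq : L * R * √(((n : ℝ) + 2) / K) ≤ ε * ((n : ℝ) + 2) / 10 := by
    refine abs_le_of_sq_le_sq' ?_ (by positivity) |>.2
    rw [mul_pow, Real.sq_sqrt (by positivity)]
    rw [div_le_iff₀ (by positivity)] at hTK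
    rw [← mul_div_assoc, div_le_iff₀ hKpos]
    nlinarith [mul_le_mul_of_nonneg_left hTK (by positivity : 0 ≤ ((n : ℝ) + 2) / 100)]
  have hmono : √(((n : ℝ) + 1) / K) ≤ √(((n : ℝ) + 2) / K) := by
    gcongr
    norm_num
  have h1 : L * R / 4 * √(((n : ℝ) + 1) / K) ≤ ε * ((n : ℝ) + 2) / 40 := by
    have := mul_le_mul_of_nonneg_left hmono (by positivity : 0 ≤ L * R)
    linarith
  have hn0 : (0 : ℝ) ≤ n := n.cast_nonneg
  -- The shares add up to 1/20 + 1/40 + 1/20 + 1/10 = 9/40, below the required 1/4.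
  calc _ ≤ ((n : ℝ) + 2) * (ε * ((n : ℝ) + 2) / 20 + ε * ((n : ℝ) + 2) / 40) +
        (ε * ((n : ℝ) + 2) / 20 + ε * ((n : ℝ) + 2) / 10) * ((n : ℝ) + 2) := by
        have e : L * R * (D + √(((n : ℝ) + 2) / K)) = L * R * D + L * R * √(((n : ℝ) + 2) / K) := by
          ring
        rw [e]
        gcongr
        norm_num
    _ ≤ ((n : ℝ) + 2) ^ 2 / 4 * ε := by nlinarith [mul_nonneg hε.le (sq_nonneg ((n : ℝ) + 2))]

end Parameters

/-! ### The output of the distributed algorithm -/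

section Output

variable {d : ℕ} {S : Set (Vec d)} {f : Vec d → ℝ} {s : Vec d → Vec d} {R L ε : ℝ}
  {Ω : Type*} [MeasurableSpace Ω] {P : Measure Ω} [IsProbabilityMeasure P]
  {X : ℕ → ℕ → Ω → Vec d}

/-- Samples and oracle may be replaced by everywhere well-behaved versions. -/
theorem exists_version_stateVal (hcv : Convex ℝ S) (hcl : IsClosed S) (h0 : (0 : Vec d) ∈ S)
    (hR : 0 < R) (hL : 0 < L) (hd : 0 < d) {K : ℕ}
    (hsm : Measurable s) (hsb : ∀ᵐ θ, ‖s θ‖ ≤ L)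
    (hlaw : ∀ t k, HasLaw (X t k) (stdGaussian (Vec d)) P)
    (hind : iIndepFun (fun p : ℕ × ℕ => X p.1 p.2) P) :
    ∃ (s' : Vec d → Vec d) (W : ℕ → ℕ → Ω → Vec d), Measurable s' ∧ (∀ θ, ‖s' θ‖ ≤ L) ∧
      (∀ᵐ θ, s θ = s' θ) ∧ (∀ t k, Measurable (W t k)) ∧
      (∀ t k, P.map (W t k) = stdGaussian (Vec d)) ∧
      iIndepFun (fun p : ℕ × ℕ => W p.1 p.2) P ∧
      ∀ᵐ ω ∂P, ∀ t, stateVal S s R L K (fun t k => X t k ω) t =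
        stateVal S s' R L K (fun t k => W t k ω) t := by
  classical
  -- Setting the oracle to 0 where it exceeds L changes it on a null set only. Likewise `HasLaw`
  -- gives almost everywhere measurability, so measurable versions of the samples are taken.
  set s' : Vec d → Vec d := {θ | ‖s θ‖ ≤ L}.indicator s with hs'
  set W : ℕ → ℕ → Ω → Vec d := fun t k => (hlaw t k).aemeasurable.mk
  have hs'm : Measurable s' := hsm.indicator (measurableSet_le hsm.norm measurable_const)
  have hss' : ∀ᵐ θ, s θ = s' θ := by
    filter_upwards [hsb] with θ hθ
    exact (Set.indicator_of_mem (s := {θ | ‖s θ‖ ≤ L}) hθ s).symm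
  have hW : ∀ t k, Measurable (W t k) := fun t k => (hlaw t k).aemeasurable.measurable_mk
  have hXW : ∀ t k, X t k =ᵐ[P] W t k := fun t k => (hlaw t k).aemeasurable.ae_eq_mk
  have hWlaw : ∀ t k, P.map (W t k) = stdGaussian (Vec d) := fun t k => by
    rw [← Measure.map_congr (hXW t k), (hlaw t k).map_eq]
  have hWind : iIndepFun (fun p : ℕ × ℕ => W p.1 p.2) P := hind.congr fun p => hXW p.1 p.2
  refine ⟨s', W, hs'm, fun θ => ?_, hss', hW, hWlaw, hWind, ?_⟩
  · by_cases h : θ ∈ {θ | ‖s θ‖ ≤ L}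
    · rw [hs', Set.indicator_of_mem h]
      exact h
    · rw [hs', Set.indicator_of_notMem h, norm_zero]
      exact hL.le
  · have hgood : ∀ᵐ ω ∂P, ∀ t k,
        s (queryPoint S s' R L K (fun t k => W t k ω) t + gammaSmooth R d t • W t k ω) =
        s' (queryPoint S s' R L K (fun t k => W t k ω) t + gammaSmooth R d t • W t k ω) := by
      rw [ae_all_iff]
      intro t
      rw [ae_all_iff]
      intro k
      have hWm : ∀ p : ℕ × ℕ, Measurable (W p.1 p.2) := fun p => hW _ _
      exact ae_sample_of_ae (otherSamples_le hWm (t, k)) (hW t k) (hWlaw t k)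
        (indep_otherSamples hWm hWind (t, k))
        (@measurable_queryPoint d S s' R L K Ω
          (otherSamples (fun p : ℕ × ℕ => W p.1 p.2) (t, k)) W hcv hcl ⟨0, h0⟩ hs'm t
          fun a ha l => measurable_otherSamples_of_lt ha l k)
        (measurableSet_eq_fun hsm hs'm) hss' (gammaSmooth_pos hR hd t).ne'
    have hall : ∀ᵐ ω ∂P, ∀ t k, X t k ω = W t k ω :=
      ae_all_iff.2 fun t => ae_all_iff.2 fun k => hXW t k
    filter_upwards [hgood, hall] with ω h1 h2 t
    rw [show (fun t k => X t k ω) = fun t k => W t k ω from funext fun t => funext fun k => h2 t k]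
    exact stateVal_congr h1 t

/-- Randomized smoothing reaches precision `ε` in expectation. -/
theorem integral_output_sub_le (hcv : Convex ℝ S) (hcl : IsClosed S) (h0 : (0 : Vec d) ∈ S)
    (hSR : ∀ θ ∈ S, ‖θ‖ ≤ R) (hL : 0 ≤ L) (hε : 0 < ε)
    (hfc : ConvexOn ℝ Set.univ f) (hf : ∀ x y, |f x - f y| ≤ L * ‖x - y‖)
    (hsm : Measurable s) (hs : ∀ᵐ θ, ∀ x, f θ + inner ℝ (s θ) (x - θ) ≤ f x)
    (hlaw : ∀ t k, HasLaw (X t k) (stdGaussian (Vec d)) P)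
    (hind : iIndepFun (fun p : ℕ × ℕ => X p.1 p.2) P) :
    Integrable (fun ω => f (stateVal S s R L (numSamples R L ε d) (fun t k => X t k ω)
      (numIter R L ε d)).x) P ∧
    ∀ θ ∈ S, ∫ ω, f (stateVal S s R L (numSamples R L ε d) (fun t k => X t k ω)
      (numIter R L ε d)).x ∂P - f θ ≤ ε := by
  have hR0 : 0 ≤ R := (norm_nonneg _).trans (hSR 0 h0)
  by_cases hmain : 0 < R ∧ 0 < L ∧ 0 < d
  · obtain ⟨hR, hL, hd⟩ := hmain
    have hsb : ∀ᵐ θ, ‖s θ‖ ≤ L := by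
      filter_upwards [hs] with θ hθ
      exact norm_subgradient_le hf hL.le hθ
    obtain ⟨s', W, hs'm, hs'b, hss', hW, hWlaw, hWind, heq⟩ :=
      exists_version_stateVal (K := numSamples R L ε d) hcv hcl h0 hR hL hd hsm hsb hlaw hind
    have hs' : ∀ᵐ θ, ∀ x, f θ + inner ℝ (s' θ) (x - θ) ≤ f x := by
      filter_upwards [hs, hss'] with θ h1 h2
      rwa [← h2]
    have hae : (fun ω => f (stateVal S s R L (numSamples R L ε d) (fun t k => X t k ω)
        (numIter R L ε d)).x) =ᵐ[P] fun ω => f (stateVal S s' R L (numSamples R L ε d)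
        (fun t k => W t k ω) (numIter R L ε d)).x := by
      filter_upwards [heq] with ω h
      rw [h]
    refine ⟨(integrable_comp_stateVal hcv hcl h0 hSR hL.le hf hs'm hW _).congr hae.symm, ?_⟩
    intro θ hθ
    rw [integral_congr_ae hae]
    obtain ⟨n, hn⟩ := Nat.exists_eq_succ_of_ne_zero (numIter_pos hR hL hε hd).ne'
    have h1 := integral_gap_le (P := P) hcv hcl h0 hSR hR hL hd (numSamples_pos hR hL hε hd) hfc hf
      hs'm hs'b hs' hW hWlaw hWind hθ n
    have h2 := h1.trans (error_bound_le hR hL hε hd hn)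
    rw [hn]
    -- The weight 1/α_n² multiplying the gap is at least (n + 2)²/4, the factor in front of ε in
    -- `error_bound_le`.
    have h3 := le_inv_alpha n
    have h4 : ((n : ℝ) + 2) ^ 2 / 4 ≤ (alpha n)⁻¹ ^ 2 := by
      calc ((n : ℝ) + 2) ^ 2 / 4 = (((n : ℝ) + 2) / 2) ^ 2 := by ring
        _ ≤ _ := by gcongr
    have h5 : 0 < (alpha n)⁻¹ ^ 2 := by have := alpha_pos n; positivity
    exact le_of_mul_le_mul_left (h2.trans (mul_le_mul_of_nonneg_right h4 hε.le)) h5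
  -- In the degenerate cases T = 0 (for d = 0 because 0^{1/4} = 0) and the output is 0, which is
  -- optimal since L‖θ‖ = 0 on S.
  · have hprod : R = 0 ∨ L = 0 ∨ d = 0 := by
      by_contra! h
      exact hmain ⟨hR0.lt_of_ne' h.1, hL.lt_of_ne' h.2.1, Nat.pos_of_ne_zero h.2.2⟩
    have hT : numIter R L ε d = 0 := by
      rw [numIter]
      rcases hprod with rfl | rfl | rfl <;> simp
    simp only [hT, stateVal]
    refine ⟨integrable_const _, fun θ hθ => ?_⟩
    have h1 := (le_abs_self _).trans (hf 0 θ)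
    have h2 : L * ‖0 - θ‖ = 0 := by
      rw [zero_sub, norm_neg]
      rcases hprod with rfl | rfl | rfl
      · rw [le_antisymm (hSR θ hθ) (norm_nonneg _), mul_zero]
      · rw [zero_mul]
      · rw [Subsingleton.elim θ 0, norm_zero, mul_zero]
    rw [integral_const, probReal_univ, one_smul]
    linarith

end Output

/-! ### Total running time -/

section Time

variable {V Ω : Type*} [Fintype V] {Gr : Digraph V} {r : V} {d : ℕ}

/-- The constants are 40 = 20 · 2, for two tree traversals per iteration, and 100 = 20 · 5; integer
factors can be pulled out of the ceilings. -/
theorem drs_time_le (A : Arborescence Gr r) (B : Arborescence (reverse Gr) r) (τ : ℝ≥0)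
    (hA : ∀ v, A.depth v ≤ diam Gr) (hB : ∀ v, B.depth v ≤ diam Gr)
    (S : Set (Vec d)) (g : V → Vec d → Vec d) (X : ℕ → ℕ → Ω → Vec d) (R L ε : ℝ) (ω : Ω) :
    ((drs A B τ S g X R L ε ω).time : ℝ) ≤
      40 * ⌈R * L * (d : ℝ) ^ (1 / 4 : ℝ) / ε⌉₊ * (diam Gr * τ) +
        100 * ⌈R * L * (d : ℝ) ^ (1 / 4 : ℝ) / ε⌉₊ *
          ⌈R * L * (d : ℝ) ^ (-(1 / 4) : ℝ) / ε⌉₊ := by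
  have h := drsState_time_le A B τ S g X R L (numSamples R L ε d) ω hA hB (numIter R L ε d)
  have h' : ((drs A B τ S g X R L ε ω).time : ℝ) ≤
      (numIter R L ε d : ℝ) * (2 * (diam Gr * τ) + numSamples R L ε d) := by
    exact_mod_cast h
  have hT : (numIter R L ε d : ℝ) ≤ 20 * ⌈R * L * (d : ℝ) ^ (1 / 4 : ℝ) / ε⌉₊ := by
    exact_mod_cast numIter_le
  have hK : (numSamples R L ε d : ℝ) ≤ 5 * ⌈R * L * (d : ℝ) ^ (-(1 / 4) : ℝ) / ε⌉₊ := by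
    exact_mod_cast numSamples_le
  refine h'.trans ((mul_le_mul hT (add_le_add_right hK _) (by positivity)
    (by positivity)).trans_eq ?_)
  ring

/-- The hypothesis on ε makes the first ceiling at most twice its argument. The second argument may
be small, so its ceiling costs an additive 1, which produces the term without M. The constant 200 is
100 · 2. -/
theorem time_bound_le {R L ε M : ℝ} (hε : 0 < ε) (hRL : 0 ≤ R * L) (hM : 0 ≤ M)
    (h : ε ≤ R * L * (d : ℝ) ^ (1 / 4 : ℝ)) :
    40 * ⌈R * L * (d : ℝ) ^ (1 / 4 : ℝ) / ε⌉₊ * M +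
        100 * ⌈R * L * (d : ℝ) ^ (1 / 4 : ℝ) / ε⌉₊ *
          ⌈R * L * (d : ℝ) ^ (-(1 / 4) : ℝ) / ε⌉₊ ≤
      200 * (R * L / ε * (M + 1) * (d : ℝ) ^ (1 / 4 : ℝ) + (R * L / ε) ^ 2) := by
  have hd : d ≠ 0 := by
    rintro rfl
    norm_num at h
    linarith
  have hD : 0 < (d : ℝ) ^ (1 / 4 : ℝ) := by positivity
  rw [Real.rpow_neg d.cast_nonneg]
  set D := (d : ℝ) ^ (1 / 4 : ℝ)
  have ha : 1 ≤ R * L * D / ε := (one_le_div hε).2 h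
  have h1 : (⌈R * L * D / ε⌉₊ : ℝ) ≤ 2 * (R * L * D / ε) := by
    have := (Nat.ceil_lt_add_one (zero_le_one.trans ha)).le
    linarith
  have h2 : (⌈R * L * D⁻¹ / ε⌉₊ : ℝ) ≤ R * L * D⁻¹ / ε + 1 :=
    (Nat.ceil_lt_add_one (by positivity)).le
  have hX : 0 ≤ R * L * D / ε * M := by positivity
  calc _ ≤ 40 * (2 * (R * L * D / ε)) * M +
        100 * (2 * (R * L * D / ε)) * (R * L * D⁻¹ / ε + 1) := by gcongr
    _ = 80 * (R * L * D / ε * M) + 200 * (R * L * D / ε + (R * L / ε) ^ 2) := by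
        field_simp
        ring
    _ ≤ 200 * (R * L * D / ε * M) + 200 * (R * L * D / ε + (R * L / ε) ^ 2) := by linarith
    _ = _ := by ring

end Time

end DistOpt

/-! ### The main theorem -/

theorem mainTheorem5 :
    ∃ C : ℝ, 0 < C ∧
      ∀ (V : Type*) [Fintype V] (Gr : Digraph V) (_ : DistOpt.StronglyConnected Gr) (τ : ℝ≥0)
        (r : V) (A : DistOpt.Arborescence Gr r)
        (B : DistOpt.Arborescence (DistOpt.reverse Gr) r)
        (_ : ∀ v, A.depth v ≤ DistOpt.diam Gr) (_ : ∀ v, B.depth v ≤ DistOpt.diam Gr)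
        (d : ℕ) (S : Set (DistOpt.Vec d)) (R L ε : ℝ)
        (_ : Convex ℝ S) (_ : IsClosed S) (_ : (0 : DistOpt.Vec d) ∈ S)
        (_ : ∀ θ ∈ S, ‖θ‖ ≤ R) (_ : 0 ≤ L) (_ : 0 < ε)
        (f : V → DistOpt.Vec d → ℝ)
        (_ : ConvexOn ℝ Set.univ (DistOpt.avg f))
        (_ : ∀ θ θ', |DistOpt.avg f θ - DistOpt.avg f θ'| ≤ L * ‖θ - θ'‖)
        (g : V → DistOpt.Vec d → DistOpt.Vec d) (_ : ∀ i, Measurable (g i))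
        (_ : ∀ i, ∀ᵐ θ, DistOpt.IsSubgradientAt (f i) (g i θ) θ)
        (Ω : Type*) [MeasurableSpace Ω] (P : Measure Ω) [IsProbabilityMeasure P]
        (X : ℕ → ℕ → Ω → DistOpt.Vec d)
        (_ : ∀ t k, HasLaw (X t k) (stdGaussian (DistOpt.Vec d)) P)
        (_ : iIndepFun (fun p : ℕ × ℕ => X p.1 p.2) P),
        -- the output is feasible and its expected error is at most `ε`
        (∀ ω, (DistOpt.drs A B τ S g X R L ε ω).val ∈ S) ∧
        Integrable (fun ω => DistOpt.avg f (DistOpt.drs A B τ S g X R L ε ω).val) P ∧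
        (∀ θs ∈ S, IsMinOn (DistOpt.avg f) S θs →
          ∫ ω, DistOpt.avg f (DistOpt.drs A B τ S g X R L ε ω).val ∂P - DistOpt.avg f θs ≤ ε) ∧
        -- explicit bound on the running time, for all `ε`
        (∀ ω, ((DistOpt.drs A B τ S g X R L ε ω).time : ℝ) ≤
          40 * ⌈R * L * (d : ℝ) ^ (1 / 4 : ℝ) / ε⌉₊ * (DistOpt.diam Gr * τ) +
          100 * ⌈R * L * (d : ℝ) ^ (1 / 4 : ℝ) / ε⌉₊ *
            ⌈R * L * (d : ℝ) ^ (-(1 / 4) : ℝ) / ε⌉₊) ∧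
        -- its order of magnitude
        (ε ≤ R * L * (d : ℝ) ^ (1 / 4 : ℝ) →
          ∀ ω, ((DistOpt.drs A B τ S g X R L ε ω).time : ℝ) ≤
            C * (R * L / ε * (DistOpt.diam Gr * τ + 1) * (d : ℝ) ^ (1 / 4 : ℝ) +
              (R * L / ε) ^ 2)) := by
  refine ⟨200, by norm_num, ?_⟩
  intro V _ Gr _ τ r A B hA hB d S R L ε hcv hcl h0 hSR hL hε f hfc hf g hgm hg Ω _ P _ X hlaw hind
  have hval : ∀ ω, (DistOpt.drs A B τ S g X R L ε ω).val =
      (DistOpt.stateVal S (DistOpt.avgOracle g) R L (DistOpt.numSamples R L ε d)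
        (fun t k => X t k ω) (DistOpt.numIter R L ε d)).x := fun ω =>
    congrArg DistOpt.RootState.x (DistOpt.drsState_val A B τ S g X R L _ ω _)
  have hsm : Measurable (DistOpt.avgOracle g) := by
    unfold DistOpt.avgOracle
    fun_prop
  have hs : ∀ᵐ θ, ∀ x, DistOpt.avg f θ + inner ℝ (DistOpt.avgOracle g θ) (x - θ) ≤
      DistOpt.avg f x := by
    filter_upwards [ae_all_iff.2 hg] with θ hθ
    exact (DistOpt.isSubgradientAt_iff_of_convexOn hfc _ _).1 (DistOpt.isSubgradientAt_avg hθ)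
  obtain ⟨hint, hgap⟩ := DistOpt.integral_output_sub_le (R := R) hcv hcl h0 hSR hL hε hfc hf hsm hs
    hlaw hind
  have htime := DistOpt.drs_time_le A B τ hA hB S g X R L ε
  have hR : 0 ≤ R := (norm_nonneg _).trans (hSR 0 h0)
  simp only [hval]
  exact ⟨fun ω => (DistOpt.stateVal_mem hcv hcl h0 _ _).1, hint, fun θs hθs _ => hgap θs hθs, htime,
    fun h ω => (htime ω).trans
      (DistOpt.time_bound_le hε (mul_nonneg hR hL) (by positivity) h)⟩
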